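/- Let $(\Omega,\mathcal F,\mathbb P)$ be a countably generated probability space, let $F,G,\mathcal H_1,\mathcal H_2,\mathcal H_3$ be real separable Hilbert spaces, let $x\in L^2(\Omega;F)$, $y\in L^2(\Omega;G)$, $r\in\mathbb N$, and let $W_x:F\to\mathcal H_1$, $W_A:\mathcal H_2\to\mathcal H_1$, $W_y:G\to\mathcal H_3$ be bounded linear operators such that $W_A$ has closed range. Notation. For square-integrable $w,z$, the uncentred covariance $C_{wz}$ is the bounded operator with $\langle C_{wz}e,f\rangle=\mathbb E[\langle w,f\rangle\langle e,z\rangle]$, and $C_y:=C_{yy}$. $P_V$ is the orthogonal projection onto a closed subspace $V$. For a bounded operator $S:\mathcal H\to\mathcal K$, the Moore–Penrose inverse $S^\dagger$ is the linear operator with domain $\operatorname{ran}S\oplus(\operatorname{ran}S)^\perp$ that equals $(S|_{(\ker S)^\perp})^{-1}$ on $\operatorname{ran}S$ and $0$ on $(\operatorname{ran}S)^\perp$; a product $S_1S_2$ of partially defined operators has domain $S_2^{-1}(\operatorname{dom}S_1)$. A singular value decomposition of a compact operator $T$ is an expansion $Th=\sum_i\sigma_i\langle h,e_i\rangle f_i$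 over $1\le i\le\operatorname{rank}T$ (all $i\ge1$ if the rank is infinite) with $(\sigma_i)$ nonnegative and nonincreasing and $(e_i)$, $(f_i)$ orthonormal; an operator of the form $(T)_r=\sum_{i\le \min(r,\operatorname{rank}T)}\sigma_i\langle\cdot,e_i\rangle f_i$ for some singular value decomposition is called a rank-$r$ truncated SVD of $T$. Consider the problem $$\min\{\mathbb E\|W_xx-W_AAW_yy\|^2:\ A:\mathcal H_3\to\mathcal H_2\text{ bounded, }\operatorname{rank}A\le r\}.\tag{1}$$ Put $B:=C_y^{1/2}W_y^*$ and $$T:=P_{\overline{\operatorname{ran}B}}\,(C_y^{1/2})^\dagger\, C_{yx}\,W_x^*\,P_{\operatorname{ran}W_A}.$$ Then: 1. $T$ is everywhere defined on $\mathcal H_1$, and it is a compact operator $\mathcal H_1\to G$. 2. Problem (1) has a solution if and only if some rank-$r$ truncated SVD $Y$ of $T$ satisfies $\operatorname{ran}Y\subseteq\operatorname{ran}B$. Call such a $Y$ admissible. 3. For every admissible $Y$, the operator $B^\dagger Y$ is everywhere defined and bounded, and $$\hat A:=W_A^\dagger\,(B^\dagger Y)^*$$ is an everywhere defined bounded operator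 which solves (1) and has the minimality property $$P_{(\ker W_A)^\perp}\,\hat A\,P_{(\ker B)^\perp}=\hat A .\tag{2}$$ 4. For every admissible $Y$, the operator $\hat A$ of part 3 is the only solution of (1) with property (2) if and only if $Y$ is the only admissible truncated SVD, i.e. the only rank-$r$ truncated SVD of $T$ (as an operator) whose range is contained in $\operatorname{ran}B$. -/

import Mathlib

open MeasureTheory ContinuousLinearMap

noncomputable section

namespace RankConstrained

section Operators

variable {H K L : Type*}
  [NormedAddCommGroup H] [InnerProductSpace ℝ H]
  [NormedAddCommGroup K] [InnerProductSpace ℝ K]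
  [NormedAddCommGroup L] [InnerProductSpace ℝ L]

/-- The orthogonal projection of `K` onto the closure of the linear subspace `V`. -/
def projClosure [CompleteSpace K] (V : Submodule ℝ K) : K →L[ℝ] K :=
  V.topologicalClosure.starProjection

/-- The (partially defined) inverse of the injective map `T|_{(ker T)ᗮ} : (ker T)ᗮ → K`;
its domain is `ran T`. -/
def restrictedInverse (T : H →L[ℝ] K) : K →ₗ.[ℝ] H :=
  ((T : H →ₗ[ℝ] K).toPMap (LinearMap.ker (T : H →ₗ[ℝ] K))ᗮ).inverse

theorem ker_restricted_eq_bot (T : H →L[ℝ] K) :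
    LinearMap.ker ((T : H →ₗ[ℝ] K).toPMap (LinearMap.ker (T : H →ₗ[ℝ] K))ᗮ).toFun = ⊥ := by
  rw [LinearMap.ker_eq_bot']
  rintro ⟨h, hh⟩ h0
  have h1 : h ∈ LinearMap.ker (T : H →ₗ[ℝ] K) := h0
  have h2 : inner ℝ h h = 0 := (Submodule.mem_orthogonal _ _).1 hh h h1
  exact Subtype.ext (inner_self_eq_zero.1 h2)

variable [CompleteSpace H]

theorem restrictedInverse_domain (T : H →L[ℝ] K) :
    (restrictedInverse T).domain = LinearMap.range (T : H →ₗ[ℝ] K) := by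
  unfold restrictedInverse
  rw [LinearPMap.inverse_domain]
  ext k
  constructor
  · rintro ⟨⟨h, hh⟩, rfl⟩
    exact ⟨h, rfl⟩
  · rintro ⟨h, rfl⟩
    set N := LinearMap.ker (T : H →ₗ[ℝ] K) with hN
    have : CompleteSpace N := T.completeSpace_ker
    refine ⟨⟨h - N.starProjection h, N.sub_starProjection_mem_orthogonal h⟩, ?_⟩
    have h1 : T (N.starProjection h) = 0 := N.starProjection_apply_mem h
    change T (h - N.starProjection h) = T h
    rw [map_sub, h1, sub_zero]

theorem moorePenrose_agree (T : H →L[ℝ] K) (x : (restrictedInverse T).domain)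
    (y : ((0 : K →ₗ[ℝ] H).toPMap (LinearMap.range (T : H →ₗ[ℝ] K))ᗮ).domain)
    (hxy : (x : K) = y) :
    restrictedInverse T x =
      (0 : K →ₗ[ℝ] H).toPMap (LinearMap.range (T : H →ₗ[ℝ] K))ᗮ y := by
  have hx : (x : K) ∈ LinearMap.range (T : H →ₗ[ℝ] K) :=
    restrictedInverse_domain T ▸ x.2
  have hy : (y : K) ∈ (LinearMap.range (T : H →ₗ[ℝ] K))ᗮ := y.2
  have h0 : (x : K) = 0 := by
    rw [← hxy] at hy
    exact inner_self_eq_zero.1 ((Submodule.mem_orthogonal _ _).1 hy _ hx)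
  have h1 : x = 0 := Subtype.ext h0
  rw [h1, LinearPMap.map_zero]
  rfl

/-- The Moore--Penrose inverse `T† : ran T ⊕ (ran T)ᗮ → H` of a bounded operator `T : H → K`:
the partially defined linear operator equal to the inverse of `T|_{(ker T)ᗮ}` on `ran T` and
to zero on `(ran T)ᗮ`. -/
def moorePenrose (T : H →L[ℝ] K) : K →ₗ.[ℝ] H :=
  (restrictedInverse T).sup ((0 : K →ₗ[ℝ] H).toPMap (LinearMap.range (T : H →ₗ[ℝ] K))ᗮ)
    (moorePenrose_agree T)

theorem moorePenrose_domain (T : H →L[ℝ] K) :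
    (moorePenrose T).domain =
      LinearMap.range (T : H →ₗ[ℝ] K) ⊔ (LinearMap.range (T : H →ₗ[ℝ] K))ᗮ := by
  change (restrictedInverse T).domain ⊔ _ = _
  rw [restrictedInverse_domain]
  rfl

/-- The composition `S R` of a partially defined operator `S` with an everywhere defined
operator `R`, on the domain `R⁻¹(dom S)`. -/
def compOn (S : K →ₗ.[ℝ] L) (R : H →L[ℝ] K) : H →ₗ.[ℝ] L where
  domain := S.domain.comap (R : H →ₗ[ℝ] K)
  toFun := S.toFun ∘ₗ (R : H →ₗ[ℝ] K).restrict fun _ hx => hx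

/-- `R` is everywhere defined and bounded, and coincides with the partially defined
operator `S` (in particular `dom S = H`). -/
def IsOperator (S : H →ₗ.[ℝ] K) (R : H →L[ℝ] K) : Prop :=
  (R : H →ₗ[ℝ] K).toPMap ⊤ = S

/-- The positive self-adjoint square root `C^{1/2}` of a positive self-adjoint operator `C`,
i.e. the (unique) positive self-adjoint `S` with `S S = C`. (`IsPositive` includes symmetry.) -/
def opSqrt (C : H →L[ℝ] H) : H →L[ℝ] H :=
  Classical.epsilon fun S : H →L[ℝ] H => S.IsPositive ∧ S ∘L S = C

/-- The set of bounded operators of rank at most `r`. -/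
def boundedRank (r : ℕ) (H K : Type*) [NormedAddCommGroup H] [InnerProductSpace ℝ H]
    [NormedAddCommGroup K] [InnerProductSpace ℝ K] : Set (H →L[ℝ] K) :=
  {A | (A : H →ₗ[ℝ] K).rank ≤ (r : Cardinal)}

/-- `T = ∑_{i < rank T} σ i • (f i ⊗ e i)` is a singular value decomposition of `T`: `σ` is
nonnegative and nonincreasing, `(e i)` and `(f i)` are orthonormal systems indexed by
`I = {i | i < rank T}` (all of `ℕ` if `T` has infinite rank). Indices start at `0` and `σ` is
extended by zero outside `I`, so that the values of `e` and `f` outside `I` play no role. -/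
structure IsSVD (T : H →L[ℝ] K) (σ : ℕ → ℝ) (e : ℕ → H) (f : ℕ → K) : Prop where
  nonneg : ∀ i, 0 ≤ σ i
  antitone : Antitone σ
  eq_zero : ∀ i : ℕ, (T : H →ₗ[ℝ] K).rank ≤ (i : Cardinal) → σ i = 0
  orthonormal_left :
    Orthonormal ℝ fun i : {i : ℕ // (i : Cardinal) < (T : H →ₗ[ℝ] K).rank} => e i
  orthonormal_right :
    Orthonormal ℝ fun i : {i : ℕ // (i : Cardinal) < (T : H →ₗ[ℝ] K).rank} => f i
  hasSum : ∀ h : H, HasSum (fun i => (σ i * inner ℝ (e i) h) • f i) (T h)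

/-- `Y` is a rank-`r` truncated singular value decomposition `(T)_r` of `T`: the sum of the
first `r` terms of some singular value decomposition of `T`. -/
def IsTruncatedSVD (r : ℕ) (T Y : H →L[ℝ] K) : Prop :=
  ∃ (σ : ℕ → ℝ) (e : ℕ → H) (f : ℕ → K), IsSVD T σ e f ∧
    ∀ h : H, Y h = ∑ i ∈ Finset.range r, (σ i * inner ℝ (e i) h) • f i

end Operators

section Covariance

variable {Ω : Type*} [MeasurableSpace Ω]
  {E₁ E₂ : Type*}
  [NormedAddCommGroup E₁] [InnerProductSpace ℝ E₁]
  [NormedAddCommGroup E₂] [InnerProductSpace ℝ E₂] [CompleteSpace E₂]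

/-- The uncentred covariance `C_{wz} = 𝔼[w ⊗ z] : E₁ → E₂` of `w : Ω → E₂` and `z : Ω → E₁`, as a
Bochner integral of the rank-one operators `e ↦ ⟨z ω, e⟩ w ω`. -/
def uncenteredCov (P : Measure Ω) (w : Ω → E₂) (z : Ω → E₁) : E₁ →L[ℝ] E₂ :=
  ∫ ω, InnerProductSpace.rankOne ℝ (w ω) (z ω) ∂P

/-- The defining identity of the uncentred covariance. -/
theorem inner_uncenteredCov (P : Measure Ω) {w : Ω → E₂} {z : Ω → E₁}
    (hw : MemLp w 2 P) (hz : MemLp z 2 P) (e : E₁) (f : E₂) :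
    inner ℝ (uncenteredCov P w z e) f = ∫ ω, inner ℝ (w ω) f * inner ℝ e (z ω) ∂P := by
  have hint : Integrable (fun ω => InnerProductSpace.rankOne ℝ (w ω) (z ω)) P := by
    refine Integrable.mono' (hw.norm.integrable_mul hz.norm) ?_ ?_
    · have h1 : AEStronglyMeasurable (fun ω => innerSL ℝ (z ω)) P :=
        (innerSL ℝ (E := E₁)).continuous.comp_aestronglyMeasurable hz.1
      have h2 : AEStronglyMeasurable
          (fun ω => ContinuousLinearMap.smulRightL ℝ E₁ E₂ (innerSL ℝ (z ω)) (w ω)) P :=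
        (ContinuousLinearMap.smulRightL ℝ E₁ E₂).aestronglyMeasurable_comp₂ h1 hw.1
      exact h2
    · exact Filter.Eventually.of_forall fun ω => by simp
  have hint' : Integrable (fun ω => InnerProductSpace.rankOne ℝ (w ω) (z ω) e) P :=
    (ContinuousLinearMap.apply ℝ E₂ e).integrable_comp hint
  rw [uncenteredCov, ContinuousLinearMap.integral_apply hint e, real_inner_comm,
    ← integral_inner hint' f]
  refine integral_congr_ae (Filter.Eventually.of_forall fun ω => ?_)
  simp only [InnerProductSpace.rankOne_apply, inner_smul_right]
  rw [real_inner_comm f, real_inner_comm e, mul_comm]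

end Covariance

section Problem

variable {Ω : Type*} [MeasurableSpace Ω]
  {F G H₁ H₂ H₃ : Type*}
  [NormedAddCommGroup F] [InnerProductSpace ℝ F]
  [NormedAddCommGroup G] [InnerProductSpace ℝ G]
  [NormedAddCommGroup H₁] [InnerProductSpace ℝ H₁]
  [NormedAddCommGroup H₂] [InnerProductSpace ℝ H₂]
  [NormedAddCommGroup H₃] [InnerProductSpace ℝ H₃]

/-- The weighted mean square error `𝔼 ‖W_x x - W_A A W_y y‖²`. -/
def meanSqError (P : Measure Ω) (x : Ω → F) (y : Ω → G)
    (Wx : F →L[ℝ] H₁) (WA : H₂ →L[ℝ] H₁) (Wy : G →L[ℝ] H₃) (A : H₃ →L[ℝ] H₂) : ℝ :=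
  ∫ ω, ‖Wx (x ω) - WA (A (Wy (y ω)))‖ ^ 2 ∂P

/-- `A` solves `min {𝔼 ‖W_x x - W_A A W_y y‖² : A bounded of rank at most r}`. -/
def IsSolution (P : Measure Ω) (x : Ω → F) (y : Ω → G)
    (Wx : F →L[ℝ] H₁) (WA : H₂ →L[ℝ] H₁) (Wy : G →L[ℝ] H₃) (r : ℕ) (A : H₃ →L[ℝ] H₂) : Prop :=
  A ∈ boundedRank r H₃ H₂ ∧ IsMinOn (meanSqError P x y Wx WA Wy) (boundedRank r H₃ H₂) A

variable [CompleteSpace F] [CompleteSpace G] [CompleteSpace H₁] [CompleteSpace H₂]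
  [CompleteSpace H₃]

/-- The operator `C_y^{1/2} W_y^*`. -/
def sqrtCovWeight (P : Measure Ω) (y : Ω → G) (Wy : G →L[ℝ] H₃) : H₃ →L[ℝ] G :=
  opSqrt (uncenteredCov P y y) ∘L adjoint Wy

/-- The partially defined operator
`P_{cl ran (C_y^{1/2} W_y^*)} (C_y^{1/2})† C_{yx} W_x^* P_{ran W_A}`
(`ran W_A` is closed wherever this is used). -/
def targetPMap (P : Measure Ω) (x : Ω → F) (y : Ω → G)
    (Wx : F →L[ℝ] H₁) (WA : H₂ →L[ℝ] H₁) (Wy : G →L[ℝ] H₃) : H₁ →ₗ.[ℝ] G :=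
  ((projClosure (LinearMap.range (sqrtCovWeight P y Wy : H₃ →ₗ[ℝ] G)) : G →L[ℝ] G) :
      G →ₗ[ℝ] G).compPMap
    (compOn (moorePenrose (opSqrt (uncenteredCov P y y)))
      (uncenteredCov P y x ∘L adjoint Wx ∘L projClosure (LinearMap.range (WA : H₂ →ₗ[ℝ] H₁))))

/-- The minimality property `P_{(ker W_A)ᗮ} A P_{(ker B)ᗮ} = A`. -/
def IsMinimal (WA : H₂ →L[ℝ] H₁) (B : H₃ →L[ℝ] G) (A : H₃ →L[ℝ] H₂) : Prop :=
  (LinearMap.ker (WA : H₂ →ₗ[ℝ] H₁))ᗮ.starProjection ∘L A ∘L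
    (LinearMap.ker (B : H₃ →ₗ[ℝ] G))ᗮ.starProjection = A

/-- `Y` is a rank-`r` truncated singular value decomposition of `T` with `ran Y ⊆ ran B`. -/
def IsAdmissible (r : ℕ) (T : H₁ →L[ℝ] G) (B : H₃ →L[ℝ] G) (Y : H₁ →L[ℝ] G) : Prop :=
  IsTruncatedSVD r T Y ∧
    LinearMap.range (Y : H₁ →ₗ[ℝ] G) ≤ LinearMap.range (B : H₃ →ₗ[ℝ] G)

end Problem

end RankConstrained

end

open RankConstrained

/-! Pairing with `x` and `y` gives operators `X : F → L²(P)` and `U : G → L²(P)`, Hilbert–Schmidt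
because `x` and `y` are square-integrable, with `C_y = U* U` and `C_yx = U* X`. The mean square of a
random vector is the squared Hilbert–Schmidt norm of its pairing operator, so the objective is the
squared norm of `X Wx* - U Wy* A* WA*`.

With `S = C_y^{1/2}` one has `‖U g‖ = ‖S g‖`, hence `U = J S` for a partial isometry `J` that is
isometric on the closure of `ran S`. So `U Wy* = J B`, and the unknown enters only through `N = B A*
WA*`, which vanishes on `(ran WA)ᗮ` and has range in the closure of `ran B`. Two applications of
Pythagoras turn the objective into a constant plus `‖T - N‖²`, where `T = P_B J* X Wx* P_A`. The
identity `S J* = U*` identifies this `T` with the operator of the statement, which is therefore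
everywhere defined and Hilbert–Schmidt (`exists_target`).

It remains to approximate `T` by operators `B A* WA*`. By Eckart–Young the best approximations of
rank at most `r` are exactly the truncated SVDs (`hsSq_sub_truncated_le`,
`isTruncatedSVD_of_forall_le`). The restricted problem has the same infimum: left vectors `f i` are
limits of points of `ran B`, and `σ i • e i = T* (f i)` lies in the closed space `ran WA`
(`hsSq_sub_le_of_forall_le`). Thus a solution `A` makes `B A* WA*` an admissible truncated SVD, and
every admissible `Y` factors in this way (`exists_explicit`). A minimal `A` is determined by `B A*
WA*` (`IsMinimal.eq_of_comp_eq`), so minimal solutions and admissible `Y` correspond bijectively. -/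

noncomputable section

namespace RankConstrained

set_option linter.unusedSectionVars false

/-! ### Hilbert–Schmidt norms with values in `[0, ∞]` -/

section HilbertSchmidt

open InnerProductSpace

variable {H K L : Type*}
  [NormedAddCommGroup H] [InnerProductSpace ℝ H] [CompleteSpace H]
  [NormedAddCommGroup K] [InnerProductSpace ℝ K] [CompleteSpace K]
  [NormedAddCommGroup L] [InnerProductSpace ℝ L] [CompleteSpace L]

/-- The squared Hilbert--Schmidt norm of a bounded operator, computed in some Hilbert basis. -/
def hsSq (R : H →L[ℝ] K) : ENNReal :=
  ∑' i : ↥(Classical.choose (exists_hilbertBasis ℝ H)), ‖R i‖ₑ ^ 2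

theorem enorm_sq_eq_ofReal {E : Type*} [SeminormedAddGroup E] (v : E) :
    ‖v‖ₑ ^ 2 = ENNReal.ofReal (‖v‖ ^ 2) := by
  rw [← ofReal_norm, ENNReal.ofReal_pow (norm_nonneg _)]

theorem tsum_enorm_inner_sq {ι : Type*} (b : HilbertBasis ι ℝ H) (v : H) :
    ∑' i, ‖inner ℝ (b i) v‖ₑ ^ 2 = ‖v‖ₑ ^ 2 := by
  have h := b.hasSum_inner_mul_inner v v
  have h1 : HasSum (fun i => ‖inner ℝ (b i) v‖ ^ 2) (‖v‖ ^ 2) := by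
    rw [← real_inner_self_eq_norm_sq]
    refine h.congr_fun fun i => ?_
    rw [real_inner_comm, Real.norm_eq_abs, sq_abs, sq]
  simp only [enorm_sq_eq_ofReal]
  rw [← h1.tsum_eq, ENNReal.ofReal_tsum_of_nonneg (fun i => by positivity) h1.summable]

/-- Both sides are the double sum of squared matrix entries, by Parseval. This also gives
independence of the basis, by passing through the adjoint twice. -/
theorem tsum_enorm_sq_eq_adjoint {ι κ : Type*} (b : HilbertBasis ι ℝ H) (c : HilbertBasis κ ℝ K)
    (R : H →L[ℝ] K) : ∑' i, ‖R (b i)‖ₑ ^ 2 = ∑' j, ‖adjoint R (c j)‖ₑ ^ 2 := by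
  calc ∑' i, ‖R (b i)‖ₑ ^ 2 = ∑' i, ∑' j, ‖inner ℝ (c j) (R (b i))‖ₑ ^ 2 := by
        simp only [tsum_enorm_inner_sq]
    _ = ∑' j, ∑' i, ‖inner ℝ (b i) (adjoint R (c j))‖ₑ ^ 2 := by
        rw [ENNReal.tsum_comm]
        refine tsum_congr fun j => tsum_congr fun i => ?_
        rw [adjoint_inner_right, real_inner_comm]
    _ = _ := by simp only [tsum_enorm_inner_sq]

theorem hsSq_eq_tsum {ι : Type*} (b : HilbertBasis ι ℝ H) (R : H →L[ℝ] K) :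
    hsSq R = ∑' i, ‖R (b i)‖ₑ ^ 2 := by
  obtain ⟨b', hb'⟩ := Classical.choose_spec (exists_hilbertBasis ℝ H)
  obtain ⟨w, c, -⟩ := exists_hilbertBasis ℝ K
  rw [tsum_enorm_sq_eq_adjoint b c, ← tsum_enorm_sq_eq_adjoint b' c, hb']
  rfl

theorem hsSq_adjoint (R : H →L[ℝ] K) : hsSq (adjoint R) = hsSq R := by
  obtain ⟨v, b, -⟩ := exists_hilbertBasis ℝ H
  obtain ⟨w, c, -⟩ := exists_hilbertBasis ℝ K
  rw [hsSq_eq_tsum b, hsSq_eq_tsum c, ← tsum_enorm_sq_eq_adjoint b c]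

theorem enorm_add_sq_of_inner_eq_zero {u v : H} (h : inner ℝ u v = 0) :
    ‖u + v‖ₑ ^ 2 = ‖u‖ₑ ^ 2 + ‖v‖ₑ ^ 2 := by
  simp only [enorm_sq_eq_ofReal]
  rw [← ENNReal.ofReal_add (by positivity) (by positivity)]
  congr 1
  rw [norm_add_sq_real, h]
  ring

theorem hsSq_add_of_inner_eq_zero {R S : H →L[ℝ] K} (h : ∀ v, inner ℝ (R v) (S v) = 0) :
    hsSq (R + S) = hsSq R + hsSq S := by
  obtain ⟨w, b, -⟩ := exists_hilbertBasis ℝ H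
  rw [hsSq_eq_tsum b, hsSq_eq_tsum b, hsSq_eq_tsum b, ← ENNReal.tsum_add]
  exact tsum_congr fun i => enorm_add_sq_of_inner_eq_zero (h _)

theorem hsSq_comp_of_norm_eq {R : H →L[ℝ] K} {S : H →L[ℝ] L} (h : ∀ v, ‖R v‖ = ‖S v‖) :
    hsSq R = hsSq S := by
  unfold hsSq
  simp only [enorm_sq_eq_ofReal, h]

theorem hsSq_rankOne (k : K) (a : H) : hsSq (rankOne ℝ k a) = ‖a‖ₑ ^ 2 * ‖k‖ₑ ^ 2 := by
  obtain ⟨w, b, -⟩ := exists_hilbertBasis ℝ H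
  rw [hsSq_eq_tsum b, ← tsum_enorm_inner_sq b, ← ENNReal.tsum_mul_right]
  refine tsum_congr fun i => ?_
  rw [rankOne_apply, enorm_smul, mul_pow, real_inner_comm]

/-- Adding a rank-one operator whose range is orthogonal to that of `R`. -/
theorem hsSq_add_rankOne {R : H →L[ℝ] K} {k : K} (h : ∀ v, inner ℝ k (R v) = 0) (a : H) :
    hsSq (R + rankOne ℝ k a) = hsSq R + ‖a‖ₑ ^ 2 * ‖k‖ₑ ^ 2 := by
  rw [hsSq_add_of_inner_eq_zero, hsSq_rankOne]
  intro v
  rw [rankOne_apply, inner_smul_right, real_inner_comm k, h, mul_zero]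

/-- The subtracted operator is the component of `R` along `k`, so the remainder has range orthogonal
to `k` and Pythagoras applies. -/
theorem hsSq_eq_sub_rankOne_left {k : K} (hk : ‖k‖ = 1) (R : H →L[ℝ] K) :
    hsSq R = hsSq (R - rankOne ℝ k (adjoint R k)) + ‖adjoint R k‖ₑ ^ 2 := by
  have h := hsSq_add_rankOne (R := R - rankOne ℝ k (adjoint R k)) (k := k) (fun v => ?_)
    (adjoint R k)
  · rw [sub_add_cancel, enorm_sq_eq_ofReal k, hk] at h
    simpa using h
  · rw [sub_apply, inner_sub_right, rankOne_apply, inner_smul_right, real_inner_self_eq_norm_sq, hk,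
      adjoint_inner_left]
    ring

theorem hsSq_eq_sub_rankOne_right {e : H} (he : ‖e‖ = 1) (R : H →L[ℝ] K) :
    hsSq R = hsSq (R - rankOne ℝ (R e) e) + ‖R e‖ₑ ^ 2 := by
  have h := hsSq_eq_sub_rankOne_left he (adjoint R)
  rw [adjoint_adjoint, hsSq_adjoint, ← hsSq_adjoint (adjoint R - _), map_sub, adjoint_adjoint,
    adjoint_rankOne] at h
  exact h

theorem enorm_apply_sq_le_hsSq (R : H →L[ℝ] K) {e : H} (he : ‖e‖ = 1) :
    ‖R e‖ₑ ^ 2 ≤ hsSq R := by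
  rw [hsSq_eq_sub_rankOne_right he R]
  exact le_add_self

theorem hsSq_sum_rankOne {ι : Type*} [DecidableEq ι] (s : Finset ι) {k : ι → K} (a : ι → H)
    (hk : ∀ i ∈ s, ∀ j ∈ s, i ≠ j → inner ℝ (k i) (k j) = 0) :
    hsSq (∑ i ∈ s, rankOne ℝ (k i) (a i)) = ∑ i ∈ s, ‖a i‖ₑ ^ 2 * ‖k i‖ₑ ^ 2 := by
  induction s using Finset.induction_on with
  | empty => simp [hsSq]
  | insert i s hi ih =>
    rw [Finset.sum_insert hi, Finset.sum_insert hi, add_comm, hsSq_add_rankOne, ih, add_comm]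
    · exact fun i hi j hj => hk i (Finset.mem_insert_of_mem hi) j (Finset.mem_insert_of_mem hj)
    · intro v
      rw [sum_apply, inner_sum]
      refine Finset.sum_eq_zero fun j hj => ?_
      rw [rankOne_apply, inner_smul_right, hk i (Finset.mem_insert_self _ _) j
        (Finset.mem_insert_of_mem hj) (by rintro rfl; exact hi hj), mul_zero]

theorem enorm_opNorm_sq_le_hsSq (R : H →L[ℝ] K) : ‖R‖ₑ ^ 2 ≤ hsSq R := by
  by_cases hR : hsSq R = ⊤
  · simp [hR]
  have h : ‖R‖ ≤ Real.sqrt (hsSq R).toReal := by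
    refine R.opNorm_le_bound (Real.sqrt_nonneg _) fun v => ?_
    by_cases hv : v = 0
    · simp [hv]
    have h1 : ‖(‖v‖⁻¹ • v)‖ = 1 := norm_smul_inv_norm (𝕜 := ℝ) hv
    have h2 := enorm_apply_sq_le_hsSq R h1
    rw [enorm_sq_eq_ofReal, ENNReal.ofReal_le_iff_le_toReal hR] at h2
    have h3 := Real.le_sqrt_of_sq_le h2
    rw [map_smul, norm_smul, norm_inv, norm_norm, inv_mul_le_iff₀ (norm_pos_iff.2 hv)] at h3
    linarith
  rw [enorm_sq_eq_ofReal]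
  refine ENNReal.ofReal_le_of_le_toReal ?_
  rw [← Real.sq_sqrt (ENNReal.toReal_nonneg (a := hsSq R))]
  gcongr

theorem isCompactOperator_rankOne (k : K) (a : H) : IsCompactOperator (rankOne ℝ k a) := by
  rw [rankOne_def']
  exact (isCompactOperator_of_locallyCompactSpace_dom
    (innerSL ℝ a) |>.clm_comp (.toSpanSingleton ℝ k) : _)

/-- Restricting to finitely many basis vectors gives finite-rank operators; the squared norm of the
error is bounded by a tail of the convergent series. -/
theorem isCompactOperator_of_hsSq_ne_top {R : H →L[ℝ] K} (hR : hsSq R ≠ ⊤) :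
    IsCompactOperator R := by
  classical
  obtain ⟨w, b, -⟩ := exists_hilbertBasis ℝ H
  rw [hsSq_eq_tsum b] at hR
  have hlim := ENNReal.tendsto_tsum_compl_atTop_zero hR
  have hE : ∀ s : Finset w, hsSq (R - ∑ i ∈ s, rankOne ℝ (R (b i)) (b i)) =
      ∑' i : {i // i ∉ s}, ‖R (b i)‖ₑ ^ 2 := by
    intro s
    have hb := orthonormal_iff_ite.1 b.orthonormal
    have h := tsum_subtype ((↑s : Set w)ᶜ) fun i => ‖R (b i)‖ₑ ^ 2
    rw [hsSq_eq_tsum b]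
    refine Eq.trans ?_ h.symm
    refine tsum_congr fun j => ?_
    by_cases hj : j ∈ s <;> simp [Set.indicator, hb, hj]
  refine isCompactOperator_of_tendsto (l := Filter.atTop)
    (F := fun s : Finset w => ∑ i ∈ s, rankOne ℝ (R (b i)) (b i)) (f := R) ?_ ?_
  · rw [tendsto_iff_edist_tendsto_0]
    have h2 : Filter.Tendsto (fun s : Finset w =>
        edist (∑ i ∈ s, rankOne ℝ (R (b i)) (b i)) R ^ 2) Filter.atTop (nhds 0) := by
      refine tendsto_of_tendsto_of_tendsto_of_le_of_le tendsto_const_nhds hlim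
        (fun s => zero_le) fun s => ?_
      rw [← hE, edist_comm, edist_eq_enorm_sub]
      exact enorm_opNorm_sq_le_hsSq _
    have h3 := (ENNReal.continuous_rpow_const (y := (2 : ℝ)⁻¹)).tendsto 0 |>.comp h2
    rw [ENNReal.zero_rpow_of_pos (by norm_num)] at h3
    refine h3.congr fun s => ?_
    simp only [Function.comp]
    rw [← ENNReal.rpow_natCast, ← ENNReal.rpow_mul]
    norm_num
  · refine Filter.Eventually.of_forall fun s => ?_
    have : ∑ i ∈ s, rankOne ℝ (R (b i)) (b i) ∈
        compactOperator (RingHom.id ℝ) H K :=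
      Submodule.sum_mem _ fun i _ => isCompactOperator_rankOne _ _
    exact this

theorem hsSq_neg (R : H →L[ℝ] K) : hsSq (-R) = hsSq R :=
  hsSq_comp_of_norm_eq fun v => by simp

theorem hsSq_clm_comp_le (V : K →L[ℝ] L) (R : H →L[ℝ] K) :
    hsSq (V ∘L R) ≤ ‖V‖ₑ ^ 2 * hsSq R := by
  unfold hsSq
  rw [← ENNReal.tsum_mul_left]
  refine ENNReal.tsum_le_tsum fun i => ?_
  rw [← mul_pow]
  gcongr
  exact V.le_opENorm _

theorem hsSq_clm_comp_ne_top (V : K →L[ℝ] L) {R : H →L[ℝ] K} (hR : hsSq R ≠ ⊤) :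
    hsSq (V ∘L R) ≠ ⊤ :=
  ne_top_of_le_ne_top (ENNReal.mul_ne_top (by simp) hR) (hsSq_clm_comp_le V R)

theorem hsSq_comp_clm_ne_top {R : K →L[ℝ] L} (hR : hsSq R ≠ ⊤) (V : H →L[ℝ] K) :
    hsSq (R ∘L V) ≠ ⊤ := by
  rw [← hsSq_adjoint, adjoint_comp]
  exact hsSq_clm_comp_ne_top _ (by rwa [hsSq_adjoint])

theorem hsSq_add_ne_top {R S : H →L[ℝ] K} (hR : hsSq R ≠ ⊤) (hS : hsSq S ≠ ⊤) :
    hsSq (R + S) ≠ ⊤ := by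
  have : hsSq (R + S) ≤ 2 * (hsSq R + hsSq S) := by
    unfold hsSq
    rw [← ENNReal.tsum_add, ← ENNReal.tsum_mul_left]
    refine ENNReal.tsum_le_tsum fun i => ?_
    simp only [enorm_sq_eq_ofReal]
    rw [← ENNReal.ofReal_add (by positivity) (by positivity),
      show (2 : ENNReal) = ENNReal.ofReal 2 by simp, ← ENNReal.ofReal_mul (by norm_num)]
    refine ENNReal.ofReal_le_ofReal ?_
    have := norm_add_le (R i) (S i)
    have h1 : ‖(R + S) i‖ ^ 2 ≤ (‖R i‖ + ‖S i‖) ^ 2 := by gcongr; exact this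
    nlinarith [sq_nonneg (‖R i‖ - ‖S i‖)]
  exact ne_top_of_le_ne_top (by finiteness) this

theorem hsSq_sub_ne_top {R S : H →L[ℝ] K} (hR : hsSq R ≠ ⊤) (hS : hsSq S ≠ ⊤) :
    hsSq (R - S) ≠ ⊤ := by
  rw [sub_eq_add_neg]
  exact hsSq_add_ne_top hR (by rwa [hsSq_neg])

theorem hsSq_rankOne_ne_top (k : K) (a : H) : hsSq (rankOne ℝ k a) ≠ ⊤ := by
  rw [hsSq_rankOne]
  finiteness

end HilbertSchmidt

/-! ### Singular value decompositions -/

section SingularValues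

open InnerProductSpace Filter Topology

variable {H K L : Type*}
  [NormedAddCommGroup H] [InnerProductSpace ℝ H] [CompleteSpace H]
  [NormedAddCommGroup K] [InnerProductSpace ℝ K] [CompleteSpace K]
  [NormedAddCommGroup L] [InnerProductSpace ℝ L] [CompleteSpace L]

theorem norm_sum_sq_of_pairwise_inner {ι : Type*} {x : ι → H}
    (hx : ∀ i j, i ≠ j → inner ℝ (x i) (x j) = 0) (t : Finset ι) :
    ‖∑ i ∈ t, x i‖ ^ 2 = ∑ i ∈ t, ‖x i‖ ^ 2 := by
  rw [← real_inner_self_eq_norm_sq, sum_inner]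
  refine Finset.sum_congr rfl fun i hi => ?_
  rw [inner_sum, Finset.sum_eq_single i, real_inner_self_eq_norm_sq]
  · exact fun j _ hj => hx i j hj.symm
  · exact fun h => absurd hi h

theorem summable_of_pairwise_inner {ι : Type*} {x : ι → H}
    (hx : ∀ i j, i ≠ j → inner ℝ (x i) (x j) = 0) (hs : Summable fun i => ‖x i‖ ^ 2) :
    Summable x := by
  rw [summable_iff_vanishing_norm] at hs ⊢
  intro ε hε
  obtain ⟨s, h⟩ := hs (ε ^ 2) (by positivity)
  refine ⟨s, fun t ht => ?_⟩
  have h1 := h t ht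
  rw [← norm_sum_sq_of_pairwise_inner hx, norm_pow, norm_norm] at h1
  exact lt_of_pow_lt_pow_left₀ 2 hε.le h1

/-- A compact operator attains its norm, at an eigenvector of `T* T`. -/
theorem exists_maximal_vector {T : H →L[ℝ] K} (hT : IsCompactOperator T) (h0 : T ≠ 0) :
    ∃ e : H, ‖e‖ = 1 ∧ adjoint T (T e) = ‖T‖ ^ 2 • e := by
  have hpos : 0 < ‖T‖ := norm_pos_iff.2 h0
  have hex : ∀ n : ℕ, ∃ v : H, ‖v‖ < 1 ∧ ‖T‖ - 1 / ((n : ℝ) + 1) < ‖T v‖ := fun n =>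
    T.exists_lt_apply_of_lt_opNorm (by
      have : 0 < 1 / ((n : ℝ) + 1) := by positivity
      linarith)
  choose v hv1 hv2 using hex
  have hle : ∀ n, ‖T (v n)‖ ≤ ‖T‖ := fun n =>
    (T.le_opNorm _).trans (mul_le_of_le_one_right hpos.le (hv1 n).le)
  have hlim : Tendsto (fun n => ‖T (v n)‖) atTop (𝓝 ‖T‖) := by
    refine tendsto_of_tendsto_of_tendsto_of_le_of_le ?_ tendsto_const_nhds
      (fun n => (hv2 n).le) hle
    simpa using tendsto_const_nhds.sub (tendsto_one_div_add_atTop_nhds_zero_nat (𝕜 := ℝ))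
  -- The defect in the eigenvector equation; expanding its square shows that it vanishes along a
  -- norm-maximising sequence.
  set d : ℕ → H := fun n => adjoint T (T (v n)) - ‖T‖ ^ 2 • v n with hd
  have hd2 : ∀ n, ‖d n‖ ^ 2 ≤ 2 * ‖T‖ ^ 2 * (‖T‖ ^ 2 - ‖T (v n)‖ ^ 2) := by
    intro n
    have h1 : ‖adjoint T (T (v n))‖ ≤ ‖T‖ * ‖T‖ := by
      refine ((adjoint T).le_opNorm _).trans ?_
      rw [LinearIsometryEquiv.norm_map]
      gcongr
      exact hle n
    have h2 : inner ℝ (adjoint T (T (v n))) (‖T‖ ^ 2 • v n) = ‖T‖ ^ 2 * ‖T (v n)‖ ^ 2 := by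
      rw [inner_smul_right, adjoint_inner_left, real_inner_self_eq_norm_sq]
    have h3 : ‖(‖T‖ ^ 2 • v n)‖ ≤ ‖T‖ ^ 2 := by
      rw [norm_smul, norm_pow, norm_norm]
      exact mul_le_of_le_one_right (by positivity) (hv1 n).le
    have h4 : ‖adjoint T (T (v n))‖ ^ 2 ≤ (‖T‖ * ‖T‖) ^ 2 := by gcongr
    have h5 : ‖(‖T‖ ^ 2 • v n)‖ ^ 2 ≤ (‖T‖ ^ 2) ^ 2 := by gcongr
    rw [hd, norm_sub_sq_real, h2]
    nlinarith
  have hd0 : Tendsto d atTop (𝓝 0) := by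
    rw [tendsto_zero_iff_norm_tendsto_zero]
    have h1 : Tendsto (fun n => 2 * ‖T‖ ^ 2 * (‖T‖ ^ 2 - ‖T (v n)‖ ^ 2)) atTop (𝓝 0) := by
      have := ((hlim.pow 2).const_sub (‖T‖ ^ 2)).const_mul (2 * ‖T‖ ^ 2)
      simpa using this
    have h2 : Tendsto (fun n => ‖d n‖ ^ 2) atTop (𝓝 0) :=
      squeeze_zero (fun n => by positivity) hd2 h1
    have h3 := (Real.continuous_sqrt.tendsto 0).comp h2
    simpa [Function.comp_def, Real.sqrt_sq] using h3
  obtain ⟨C, hC, hsub⟩ := hT.image_closedBall_subset_compact 1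
  obtain ⟨z, -, φ, hφ, hz⟩ := hC.tendsto_subseq (x := fun n => T (v n)) fun n =>
    hsub ⟨v n, by simpa using (hv1 n).le, rfl⟩
  -- Compactness makes only `T (v n)` converge; the small defect `d` transfers this to `v n` itself.
  have hve : Tendsto (fun n => v (φ n)) atTop (𝓝 ((‖T‖ ^ 2)⁻¹ • adjoint T z)) := by
    have h1 := (((adjoint T).continuous.tendsto z).comp hz).sub (hd0.comp hφ.tendsto_atTop)
    have h2 := h1.const_smul ((‖T‖ ^ 2)⁻¹)
    rw [sub_zero] at h2
    refine h2.congr fun n => ?_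
    simp only [hd, Function.comp, sub_sub_cancel]
    rw [smul_smul, inv_mul_cancel₀ (by positivity), one_smul]
  set e := (‖T‖ ^ 2)⁻¹ • adjoint T z
  have he1 : ‖e‖ ≤ 1 := le_of_tendsto' hve.norm fun n => (hv1 _).le
  have hTe : ‖T e‖ = ‖T‖ := tendsto_nhds_unique
    (((T.continuous.tendsto e).comp hve).norm) (hlim.comp hφ.tendsto_atTop)
  refine ⟨e, le_antisymm he1 ?_, ?_⟩
  · have := T.le_opNorm e
    rw [hTe] at this
    nlinarith
  · have h1 : Tendsto (fun n => d (φ n)) atTop (𝓝 (adjoint T (T e) - ‖T‖ ^ 2 • e)) :=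
      (((adjoint T).continuous.tendsto _).comp ((T.continuous.tendsto e).comp hve)).sub
        (hve.const_smul _)
    exact sub_eq_zero.1 (tendsto_nhds_unique h1 (hd0.comp hφ.tendsto_atTop))

/-- A singular value decomposition whose singular vectors vanish where the singular value does. -/
structure Schmidt (T : H →L[ℝ] K) (σ : ℕ → ℝ) (e : ℕ → H) (f : ℕ → K) : Prop where
  nonneg : ∀ i, 0 ≤ σ i
  antitone : Antitone σ
  inner_left : ∀ i j, inner ℝ (e i) (e j) = if i = j ∧ 0 < σ i then 1 else 0
  inner_right : ∀ i j, inner ℝ (f i) (f j) = if i = j ∧ 0 < σ i then 1 else 0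
  hasSum : ∀ h : H, HasSum (fun i => (σ i * inner ℝ (e i) h) • f i) (T h)

theorem rank_le_of_eq_sum {T : H →L[ℝ] K} {n : ℕ} {c : ℕ → H → ℝ} {f : ℕ → K}
    (h : ∀ v, T v = ∑ i ∈ Finset.range n, c i v • f i) :
    (T : H →ₗ[ℝ] K).rank ≤ (n : Cardinal) := by
  classical
  have h1 : LinearMap.range (T : H →ₗ[ℝ] K) ≤
      Submodule.span ℝ (((Finset.range n).image f : Finset K) : Set K) := by
    rintro _ ⟨v, rfl⟩
    change T v ∈ _
    rw [h]
    exact Submodule.sum_mem _ fun i hi => Submodule.smul_mem _ _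
      (Submodule.subset_span (Finset.mem_coe.2 (Finset.mem_image_of_mem f hi)))
  refine (Submodule.rank_mono h1).trans ((rank_span_finset_le _).trans ?_)
  exact_mod_cast Finset.card_image_le.trans (Finset.card_range n).le

theorem rank_le_of_hasSum {T : H →L[ℝ] K} {σ : ℕ → ℝ} {e : ℕ → H} {f : ℕ → K}
    (h0 : ∀ i, 0 ≤ σ i) (ha : Antitone σ)
    (hs : ∀ h : H, HasSum (fun i => (σ i * inner ℝ (e i) h) • f i) (T h)) {n : ℕ} (hn : σ n = 0) :
    (T : H →ₗ[ℝ] K).rank ≤ (n : Cardinal) := by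
  refine rank_le_of_eq_sum (c := fun i v => σ i * inner ℝ (e i) v) (f := f) fun v => ?_
  refine (hs v).unique (hasSum_sum_of_ne_finset_zero fun i hi => ?_)
  rw [Finset.mem_range, not_lt] at hi
  rw [le_antisymm (hn ▸ ha hi) (h0 i), zero_mul, zero_smul]

namespace Schmidt

variable {T : H →L[ℝ] K} {σ : ℕ → ℝ} {e : ℕ → H} {f : ℕ → K}

theorem norm_left (h : Schmidt T σ e f) {i : ℕ} (hi : 0 < σ i) : ‖e i‖ = 1 := by
  have h1 := h.inner_left i i
  rw [if_pos ⟨rfl, hi⟩, real_inner_self_eq_norm_sq] at h1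
  exact (pow_eq_one_iff_of_nonneg (norm_nonneg _) two_ne_zero).1 h1

theorem norm_right (h : Schmidt T σ e f) {i : ℕ} (hi : 0 < σ i) : ‖f i‖ = 1 := by
  have h1 := h.inner_right i i
  rw [if_pos ⟨rfl, hi⟩, real_inner_self_eq_norm_sq] at h1
  exact (pow_eq_one_iff_of_nonneg (norm_nonneg _) two_ne_zero).1 h1

theorem left_eq_zero (h : Schmidt T σ e f) {i : ℕ} (hi : σ i = 0) : e i = 0 := by
  have h1 := h.inner_left i i
  rwa [if_neg (by simp [hi]), inner_self_eq_zero] at h1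

theorem right_eq_zero (h : Schmidt T σ e f) {i : ℕ} (hi : σ i = 0) : f i = 0 := by
  have h1 := h.inner_right i i
  rwa [if_neg (by simp [hi]), inner_self_eq_zero] at h1

theorem apply_left (h : Schmidt T σ e f) (i : ℕ) : T (e i) = σ i • f i := by
  refine (h.hasSum (e i)).unique ?_
  convert hasSum_single i ?_ using 1
  · rw [h.inner_left]
    rcases (h.nonneg i).lt_or_eq with hi | hi
    · simp [hi]
    · simp [← hi]
  · intro j hj
    rw [h.inner_left, if_neg (by tauto), mul_zero, zero_smul]

theorem adjoint_apply_right (h : Schmidt T σ e f) (i : ℕ) : adjoint T (f i) = σ i • e i := by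
  refine ext_inner_right ℝ fun v => ?_
  rw [adjoint_inner_left, inner_smul_left]
  refine ((h.hasSum v).mapL (innerSL ℝ (f i))).unique ?_
  convert hasSum_single i ?_ using 1
  · rw [innerSL_apply_apply, inner_smul_right, h.inner_right]
    rcases (h.nonneg i).lt_or_eq with hi | hi
    · simp [hi]
    · simp [← hi]
  · intro j hj
    rw [innerSL_apply_apply, inner_smul_right, h.inner_right, if_neg (by tauto), mul_zero]

/-- If `σ i = 0`, the series stops before `i`. If `σ i > 0`, the vectors `f 0, …, f i` are
orthonormal and lie in the range. -/
theorem lt_rank_iff (h : Schmidt T σ e f) (i : ℕ) :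
    (i : Cardinal) < (T : H →ₗ[ℝ] K).rank ↔ 0 < σ i := by
  constructor
  · intro hi
    by_contra hσ
    exact absurd (rank_le_of_hasSum h.nonneg h.antitone h.hasSum
      (le_antisymm (not_lt.1 hσ) (h.nonneg i))) (not_le.2 hi)
  · intro hi
    have hpos : ∀ j : Fin (i + 1), 0 < σ j := fun j =>
      hi.trans_le (h.antitone (Nat.lt_succ_iff.1 j.2))
    have hli : LinearIndependent ℝ fun j : Fin (i + 1) => f j := by
      refine Orthonormal.linearIndependent (𝕜 := ℝ) (orthonormal_iff_ite.2 fun j k => ?_)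
      rw [h.inner_right]
      simp [hpos, Fin.ext_iff]
    have hmem : ∀ j : Fin (i + 1), f j ∈ LinearMap.range (T : H →ₗ[ℝ] K) := fun j =>
      ⟨(σ j)⁻¹ • e j, by
        change T _ = _
        rw [map_smul, h.apply_left, smul_smul, inv_mul_cancel₀ (hpos j).ne', one_smul]⟩
    have hli' : LinearIndependent ℝ
        fun j : Fin (i + 1) => (⟨f j, hmem j⟩ : LinearMap.range (T : H →ₗ[ℝ] K)) :=
      LinearIndependent.of_comp (Submodule.subtype _) hli
    have := hli'.cardinal_lift_le_rank
    simp only [Cardinal.mk_fin, Cardinal.lift_natCast] at this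
    have h2 : ((i + 1 : ℕ) : Cardinal) ≤ (T : H →ₗ[ℝ] K).rank := by
      simpa [LinearMap.rank] using this
    exact lt_of_lt_of_le (by exact_mod_cast Nat.lt_succ_self i) h2

theorem isSVD (h : Schmidt T σ e f) : IsSVD T σ e f where
  nonneg := h.nonneg
  antitone := h.antitone
  eq_zero i hi := le_antisymm
    (not_lt.1 fun h1 => absurd ((h.lt_rank_iff i).2 h1) (not_lt.2 hi)) (h.nonneg i)
  orthonormal_left := orthonormal_iff_ite.2 fun i j => by
    rw [h.inner_left]
    simp [(h.lt_rank_iff i).1 i.2, Subtype.ext_iff]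
  orthonormal_right := orthonormal_iff_ite.2 fun i j => by
    rw [h.inner_right]
    simp [(h.lt_rank_iff i).1 i.2, Subtype.ext_iff]
  hasSum := h.hasSum

end Schmidt

theorem inner_ite_of_orthonormal {p : ℕ → Prop} {σ : ℕ → ℝ} {g : ℕ → H} (hp : ∀ i, 0 < σ i → p i)
    (hg : Orthonormal ℝ fun i : {i : ℕ // p i} => g i) (i j : ℕ) :
    inner ℝ (if 0 < σ i then g i else 0) (if 0 < σ j then g j else 0) =
      if i = j ∧ 0 < σ i then (1 : ℝ) else 0 := by
  by_cases hi : 0 < σ i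
  · by_cases hj : 0 < σ j
    · have := orthonormal_iff_ite.1 hg ⟨i, hp i hi⟩ ⟨j, hp j hj⟩
      simpa [hi, hj] using this
    · have hij : i ≠ j := by
        rintro rfl
        exact hj hi
      simp [hj, hij]
  · simp [hi]

theorem IsSVD.schmidt {T : H →L[ℝ] K} {σ : ℕ → ℝ} {e : ℕ → H} {f : ℕ → K} (h : IsSVD T σ e f) :
    Schmidt T σ (fun i => if 0 < σ i then e i else 0) (fun i => if 0 < σ i then f i else 0) := by
  have hrank : ∀ i : ℕ, 0 < σ i → (i : Cardinal) < (T : H →ₗ[ℝ] K).rank := fun i hi =>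
    not_le.1 fun h1 => hi.ne' (h.eq_zero i h1)
  refine ⟨h.nonneg, h.antitone, inner_ite_of_orthonormal hrank h.orthonormal_left,
    inner_ite_of_orthonormal hrank h.orthonormal_right, fun v => ?_⟩
  refine (h.hasSum v).congr_fun fun i => ?_
  by_cases hi : 0 < σ i
  · simp [hi]
  · simp [le_antisymm (not_lt.1 hi) (h.nonneg i)]

/-- Zeroing the vectors where `σ` vanishes changes no term, and it gives inner product formulas
valid for all indices, with no reference to the rank. -/
theorem isTruncatedSVD_iff {r : ℕ} {T Y : H →L[ℝ] K} :
    IsTruncatedSVD r T Y ↔ ∃ (σ : ℕ → ℝ) (e : ℕ → H) (f : ℕ → K), Schmidt T σ e f ∧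
      Y = ∑ i ∈ Finset.range r, rankOne ℝ (f i) (σ i • e i) := by
  constructor
  · rintro ⟨σ, e, f, h, hY⟩
    refine ⟨σ, _, _, h.schmidt, ?_⟩
    ext v
    rw [hY, sum_apply]
    refine Finset.sum_congr rfl fun i _ => ?_
    rcases (h.nonneg i).lt_or_eq with hi | hi
    · simp [hi, mul_smul]
    · simp [← hi]
  · rintro ⟨σ, e, f, h, rfl⟩
    refine ⟨σ, e, f, h.isSVD, fun v => ?_⟩
    simp [sum_apply, mul_smul]

/-- Existence of singular value decompositions of Hilbert--Schmidt operators. -/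
theorem exists_schmidt {T : H →L[ℝ] K} (hT : hsSq T ≠ ⊤) :
    ∃ (σ : ℕ → ℝ) (e : ℕ → H) (f : ℕ → K), Schmidt T σ e f := by
  have hex : ∀ R : H →L[ℝ] K, hsSq R ≠ ⊤ → ∃ e : H, adjoint R (R e) = ‖R‖ ^ 2 • e ∧
      (R ≠ 0 → ‖e‖ = 1) ∧ (R = 0 → e = 0) := by
    intro R hR
    by_cases h0 : R = 0
    · exact ⟨0, by simp, fun h => absurd h0 h, fun _ => rfl⟩
    · obtain ⟨e, h1, h2⟩ := exists_maximal_vector (isCompactOperator_of_hsSq_ne_top hR) h0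
      exact ⟨e, h2, fun _ => h1, fun h => absurd h h0⟩
  choose! ε hε1 hε2 hε3 using hex
  -- Deflation: each step removes the rank-one part along a norm-attaining vector. The chosen vector
  -- is `0` once the remainder is `0`, so the recursion then stays constant.
  let A : ℕ → H →L[ℝ] K := fun n =>
    Nat.rec T (fun _ R => R - rankOne ℝ (R (ε R)) (ε R)) n
  have A0 : A 0 = T := rfl
  have AS : ∀ n, A (n + 1) = A n - rankOne ℝ (A n (ε (A n))) (ε (A n)) := fun n => rfl
  clear_value A
  have hA : ∀ n, hsSq (A n) ≠ ⊤ := by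
    intro n
    induction n with
    | zero => rwa [A0]
    | succ n ih => rw [AS]; exact hsSq_sub_ne_top ih (hsSq_rankOne_ne_top _ _)
  set s : ℕ → ℝ := fun n => ‖A n‖ with hs
  set e : ℕ → H := fun n => ε (A n) with he
  set f : ℕ → K := fun n => (s n)⁻¹ • A n (e n) with hf
  have AS' : ∀ n, A (n + 1) = A n - rankOne ℝ (A n (e n)) (e n) := AS
  have he1 : ∀ n, adjoint (A n) (A n (e n)) = s n ^ 2 • e n := fun n => hε1 _ (hA n)
  have he2 : ∀ n, 0 < s n → ‖e n‖ = 1 := fun n hn => hε2 _ (hA n) (norm_pos_iff.1 hn)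
  have he3 : ∀ n, s n = 0 → e n = 0 := fun n hn => hε3 _ (hA n) (norm_eq_zero.1 hn)
  have hs0 : ∀ n, 0 ≤ s n := fun n => norm_nonneg _
  have hAe : ∀ n, A n (e n) = s n • f n := by
    intro n
    rcases (hs0 n).lt_or_eq with hn | hn
    · rw [hf, smul_smul, mul_inv_cancel₀ hn.ne', one_smul]
    · rw [he3 n hn.symm, ← hn]; simp
  have hinner : ∀ n, inner ℝ (A n (e n)) (A n (e n)) = s n ^ 2 * inner ℝ (e n) (e n) := by
    intro n
    rw [← adjoint_inner_left, he1, inner_smul_left]; rfl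
  have hee : ∀ n, inner ℝ (e n) (e n) • A n (e n) = A n (e n) := by
    intro n
    rcases (hs0 n).lt_or_eq with hn | hn
    · rw [real_inner_self_eq_norm_sq, he2 n hn]; simp
    · rw [he3 n hn.symm]; simp
  have hee' : ∀ n, inner ℝ (e n) (e n) • e n = e n := by
    intro n
    rcases (hs0 n).lt_or_eq with hn | hn
    · rw [real_inner_self_eq_norm_sq, he2 n hn]; simp
    · rw [he3 n hn.symm]; simp
  have horth : ∀ n m, A n (e m) = 0 → inner ℝ (e n) (e m) = 0 := by
    intro n m h
    rcases (hs0 n).lt_or_eq with hn | hn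
    · have h1 : inner ℝ (adjoint (A n) (A n (e n))) (e m) = 0 := by
        rw [adjoint_inner_left, h, inner_zero_right]
      rw [he1, inner_smul_left] at h1
      exact (mul_eq_zero.1 h1).resolve_left (pow_ne_zero 2 hn.ne')
    · rw [he3 n hn.symm, inner_zero_left]
  -- Later remainders annihilate earlier singular vectors on both sides; this yields orthogonality
  -- of both families.
  have hkill : ∀ n, ∀ m < n, A n (e m) = 0 ∧ adjoint (A n) (f m) = 0 := by
    intro n
    induction n with
    | zero => intro m hm; exact absurd hm (Nat.not_lt_zero _)
    | succ n ih =>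
      intro m hm
      rcases Nat.lt_succ_iff_lt_or_eq.1 hm with hm | rfl
      · obtain ⟨h1, h2⟩ := ih m hm
        refine ⟨?_, ?_⟩
        · rw [AS', sub_apply, rankOne_apply, h1, horth n m h1]; simp
        · rw [AS', map_sub, adjoint_rankOne, sub_apply, rankOne_apply, h2, ← adjoint_inner_right,
            h2]
          simp
      · refine ⟨?_, ?_⟩
        · rw [AS', sub_apply, rankOne_apply, hee, sub_self]
        · have : adjoint (A (m + 1)) (A m (e m)) = 0 := by
            rw [AS', map_sub, adjoint_rankOne, sub_apply, rankOne_apply, he1, hinner, mul_smul,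
              hee', sub_self]
          rw [hf, map_smul, this, smul_zero]
  have hleft : ∀ i j, i < j → inner ℝ (e j) (e i) = 0 := fun i j hij =>
    horth j i (hkill j i hij).1
  have hright : ∀ i j, i < j → inner ℝ (f j) (f i) = 0 := by
    intro i j hij
    rw [hf, inner_smul_left]
    change _ * inner ℝ (A j (e j)) (f i) = 0
    rw [← adjoint_inner_right, (hkill j i hij).2, inner_zero_right, mul_zero]
  have hfn : ∀ n, inner ℝ (f n) (f n) = inner ℝ (e n) (e n) := by
    intro n
    rcases (hs0 n).lt_or_eq with hn | hn
    · simp only [hf, inner_smul_left, inner_smul_right, hinner]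
      simp only [conj_trivial]
      field_simp
    · simp only [hf, he3 n hn.symm]; simp
  have hen : ∀ n, inner ℝ (e n) (e n) = if 0 < s n then (1 : ℝ) else 0 := by
    intro n
    rcases (hs0 n).lt_or_eq with hn | hn
    · rw [if_pos hn, real_inner_self_eq_norm_sq, he2 n hn]; simp
    · rw [he3 n hn.symm, ← hn]; simp
  have hright' : ∀ i j, inner ℝ (f i) (f j) = if i = j ∧ 0 < s i then (1 : ℝ) else 0 := by
    intro i j
    rcases lt_trichotomy i j with h | rfl | h
    · rw [real_inner_comm, hright i j h, if_neg (fun h' => h.ne h'.1)]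
    · rw [hfn, hen]; simp
    · rw [hright j i h, if_neg (fun h' => h.ne' h'.1)]
  have hsum : ∀ n, A n = T - ∑ i ∈ Finset.range n, rankOne ℝ (s i • f i) (e i) := by
    intro n
    induction n with
    | zero => simp [A0]
    | succ n ih => rw [Finset.sum_range_succ, AS', ← sub_sub, ← ih, hAe]
  -- Each step removes `s n ^ 2` from a finite total, so the squares are summable and the remainders
  -- tend to zero in norm.
  have hhs : ∀ n, hsSq (A n) + ∑ i ∈ Finset.range n, ‖A i (e i)‖ₑ ^ 2 = hsSq T := by
    intro n
    induction n with
    | zero => simp [A0]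
    | succ n ih =>
      rw [← ih, Finset.sum_range_succ, AS', add_comm (∑ i ∈ Finset.range n, _), ← add_assoc]
      congr 1
      rcases (hs0 n).lt_or_eq with hn | hn
      · exact (hsSq_eq_sub_rankOne_right (he2 n hn) _).symm
      · rw [he3 n hn.symm]; simp
  have hnorm : ∀ n, ‖A n (e n)‖ = s n := by
    intro n
    rcases (hs0 n).lt_or_eq with hn | hn
    · have h := hinner n
      rw [real_inner_self_eq_norm_sq, hen, if_pos hn, mul_one] at h
      exact (sq_eq_sq₀ (norm_nonneg _) (hs0 n)).1 h
    · rw [he3 n hn.symm, ← hn]; simp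
  have hssq : Summable fun n => s n ^ 2 := by
    refine summable_of_sum_range_le (c := (hsSq T).toReal) (fun n => sq_nonneg _) fun n => ?_
    rw [← ENNReal.ofReal_le_iff_le_toReal hT, ENNReal.ofReal_sum_of_nonneg fun i _ => sq_nonneg _,
      ← hhs n]
    refine le_add_left (Finset.sum_le_sum fun i _ => ?_)
    rw [enorm_sq_eq_ofReal, hnorm]
  have hs_lim : Tendsto s atTop (𝓝 0) := by
    have h3 := (Real.continuous_sqrt.tendsto 0).comp hssq.tendsto_atTop_zero
    simpa [Function.comp_def, Real.sqrt_sq, hs0] using h3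
  refine ⟨s, e, f, hs0, antitone_nat_of_succ_le fun n => ?_, fun i j => ?_, hright', fun v => ?_⟩
  · refine (A (n + 1)).opNorm_le_bound (hs0 n) fun v => ?_
    have h1 : A (n + 1) v = A n (v - inner ℝ (e n) v • e n) := by
      rw [AS', sub_apply, rankOne_apply, map_sub, map_smul]
    rw [h1]
    refine ((A n).le_opNorm _).trans ?_
    refine mul_le_mul_of_nonneg_left ?_ (hs0 n)
    rcases (hs0 n).lt_or_eq with hn | hn
    · refine le_of_sq_le_sq ?_ (norm_nonneg _)
      rw [norm_sub_sq_real, inner_smul_right, norm_smul, he2 n hn, real_inner_comm v,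
        Real.norm_eq_abs, mul_one, sq_abs]
      nlinarith [sq_nonneg (inner ℝ (e n) v)]
    · rw [he3 n hn.symm]; simp
  · rcases lt_trichotomy i j with h | rfl | h
    · rw [real_inner_comm, hleft i j h, if_neg (fun h' => h.ne h'.1)]
    · rw [hen]; simp
    · rw [hleft j i h, if_neg (fun h' => h.ne' h'.1)]
  · have hsm : Summable fun i => (s i * inner ℝ (e i) v) • f i := by
      refine summable_of_pairwise_inner (fun i j hij => ?_) ?_
      · rw [inner_smul_left, inner_smul_right, hright' i j, if_neg (fun h => hij h.1)]; simp
      · refine Summable.of_nonneg_of_le (fun i => sq_nonneg _) (fun i => ?_)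
          (hssq.mul_right (‖v‖ ^ 2))
        rw [← mul_pow]
        gcongr
        rcases (hs0 i).lt_or_eq with hn | hn
        · have hfi : ‖f i‖ = 1 := by
            have h := hright' i i
            rw [if_pos ⟨rfl, hn⟩, real_inner_self_eq_norm_sq] at h
            exact (pow_eq_one_iff_of_nonneg (norm_nonneg _) two_ne_zero).1 h
          rw [norm_smul, hfi, mul_one, norm_mul, Real.norm_of_nonneg hn.le]
          gcongr
          simpa [he2 i hn] using norm_inner_le_norm (𝕜 := ℝ) (e i) v
        · rw [← hn]; simp
    have ht : Tendsto (fun n => ∑ i ∈ Finset.range n, (s i * inner ℝ (e i) v) • f i) atTop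
        (𝓝 (T v)) := by
      have h1 : Tendsto (fun n => A n v) atTop (𝓝 0) := by
        refine squeeze_zero_norm (fun n => (A n).le_opNorm v) ?_
        simpa using hs_lim.mul_const ‖v‖
      have h2 := h1.const_sub (T v)
      rw [sub_zero] at h2
      refine h2.congr fun n => ?_
      rw [hsum n, sub_apply, sub_sub_cancel, sum_apply]
      refine Finset.sum_congr rfl fun i _ => ?_
      rw [rankOne_apply, smul_smul, mul_comm]
    rw [← tendsto_nhds_unique hsm.hasSum.tendsto_sum_nat ht]
    exact hsm.hasSum

end SingularValues

/-! ### Eckart–Young: best approximation of rank at most `r` -/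

section EckartYoung

open InnerProductSpace Filter Topology

variable {H K L : Type*}
  [NormedAddCommGroup H] [InnerProductSpace ℝ H] [CompleteSpace H]
  [NormedAddCommGroup K] [InnerProductSpace ℝ K] [CompleteSpace K]
  [NormedAddCommGroup L] [InnerProductSpace ℝ L] [CompleteSpace L]

theorem sum_rankOne_apply {ι : Type*} (s : Finset ι) (k : ι → K) (a : ι → H) (v : H) :
    (∑ i ∈ s, rankOne ℝ (k i) (a i)) v = ∑ i ∈ s, inner ℝ (a i) v • k i := by
  simp [sum_apply]

theorem adjoint_sum_rankOne {ι : Type*} (s : Finset ι) (k : ι → K) (a : ι → H) :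
    adjoint (∑ i ∈ s, rankOne ℝ (k i) (a i)) = ∑ i ∈ s, rankOne ℝ (a i) (k i) := by
  simp [map_sum]

theorem sum_rankOne_mem_boundedRank (r : ℕ) (k : ℕ → K) (a : ℕ → H) :
    ∑ i ∈ Finset.range r, rankOne ℝ (k i) (a i) ∈ boundedRank r H K :=
  rank_le_of_eq_sum (c := fun i v => inner ℝ (a i) v) (f := k) (sum_rankOne_apply _ k a)

theorem exists_orthonormal_of_mem_boundedRank {r : ℕ} {A : H →L[ℝ] K}
    (hA : A ∈ boundedRank r H K) :
    ∃ n ≤ r, ∃ q : Fin n → K, Orthonormal ℝ q ∧ A = ∑ j, rankOne ℝ (q j) (adjoint A (q j)) := by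
  set V := LinearMap.range (A : H →ₗ[ℝ] K) with hV
  have hr : Module.rank ℝ V ≤ (r : Cardinal) := hA
  have : Module.Finite ℝ V := Module.rank_lt_aleph0_iff.1 (hr.trans_lt Cardinal.natCast_lt_aleph0)
  have hn : Module.finrank ℝ V ≤ r := by
    rw [← Module.finrank_eq_rank] at hr
    exact_mod_cast hr
  let b := stdOrthonormalBasis ℝ V
  refine ⟨_, hn, fun j => (b j : K), b.orthonormal.comp_linearIsometry V.subtypeₗᵢ, ?_⟩
  ext v
  have h := congrArg (Subtype.val) (b.sum_repr' ⟨A v, v, rfl⟩)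
  rw [sum_rankOne_apply]
  simp only [adjoint_inner_left]
  rw [Submodule.coe_sum] at h
  exact h.symm

theorem hsSq_ne_top_of_mem_boundedRank {r : ℕ} {A : H →L[ℝ] K} (hA : A ∈ boundedRank r H K) :
    hsSq A ≠ ⊤ := by
  obtain ⟨n, -, q, hq, hAq⟩ := exists_orthonormal_of_mem_boundedRank hA
  rw [hAq, hsSq_sum_rankOne _ _ fun i _ j _ hij => hq.2 hij]
  exact ENNReal.sum_ne_top.2 fun i _ => by finiteness

/-- Operators of rank at most `r` are sums of `r` rank-one operators. -/
theorem exists_eq_sum_rankOne {r : ℕ} {A : H →L[ℝ] K} (hA : A ∈ boundedRank r H K) :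
    ∃ (s : ℕ → ℝ) (e : ℕ → H) (f : ℕ → K), Schmidt A s e f ∧ (∀ i, r ≤ i → s i = 0) ∧
      A = ∑ i ∈ Finset.range r, rankOne ℝ (f i) (s i • e i) := by
  obtain ⟨s, e, f, h⟩ := exists_schmidt (hsSq_ne_top_of_mem_boundedRank hA)
  have h0 : ∀ i, r ≤ i → s i = 0 := fun i hi => h.isSVD.eq_zero i (hA.trans (by exact_mod_cast hi))
  refine ⟨s, e, f, h, h0, ?_⟩
  ext v
  rw [sum_rankOne_apply]
  refine (h.hasSum v).unique ?_
  simp only [inner_smul_left]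
  refine hasSum_sum_of_ne_finset_zero fun i hi => ?_
  rw [Finset.mem_range, not_lt] at hi
  rw [h0 i hi, zero_mul, zero_smul]

/-- A sum of `r` rank-one operators keeps this form under adjoints and compositions. -/
theorem comp_adjoint_comp_mem_boundedRank {E : Type*} [NormedAddCommGroup E]
    [InnerProductSpace ℝ E] [CompleteSpace E] {r : ℕ} {A : H →L[ℝ] K}
    (hA : A ∈ boundedRank r H K) (B : H →L[ℝ] L) (W : E →L[ℝ] K) :
    B ∘L adjoint A ∘L W ∈ boundedRank r E L := by
  obtain ⟨s, e, f, -, -, h⟩ := exists_eq_sum_rankOne hA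
  have : B ∘L adjoint A ∘L W =
      ∑ i ∈ Finset.range r, rankOne ℝ (B (s i • e i)) (adjoint W (f i)) := by
    ext v
    rw [sum_rankOne_apply, comp_apply, comp_apply, h, adjoint_sum_rankOne, sum_rankOne_apply,
      map_sum]
    simp [adjoint_inner_left]
  rw [this]
  exact sum_rankOne_mem_boundedRank r _ _

/-- After subtracting `a r`, the first `r` terms are nonnegative with weights at most `1` and the
others are nonpositive; the total weight bound `r` accounts for what was subtracted. -/
theorem sum_mul_le_sum_of_antitone {a c : ℕ → ℝ} (ha : Antitone a) (ha0 : ∀ i, 0 ≤ a i)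
    (hc0 : ∀ i, 0 ≤ c i) (hc1 : ∀ i, c i ≤ 1) {r N : ℕ} (hrN : r ≤ N)
    (hc : ∑ i ∈ Finset.range N, c i ≤ r) :
    ∑ i ∈ Finset.range N, a i * c i ≤ ∑ i ∈ Finset.range r, a i := by
  have h1 : ∑ i ∈ Finset.range N, (a i - a r) * c i ≤ ∑ i ∈ Finset.range r, (a i - a r) := by
    rw [← Finset.sum_range_add_sum_Ico _ hrN]
    have h2 : ∑ i ∈ Finset.Ico r N, (a i - a r) * c i ≤ 0 :=
      Finset.sum_nonpos fun i hi => mul_nonpos_of_nonpos_of_nonneg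
        (sub_nonpos.2 (ha (Finset.mem_Ico.1 hi).1)) (hc0 i)
    have h3 : ∑ i ∈ Finset.range r, (a i - a r) * c i ≤ ∑ i ∈ Finset.range r, (a i - a r) :=
      Finset.sum_le_sum fun i hi => mul_le_of_le_one_right
        (sub_nonneg.2 (ha (Finset.mem_range.1 hi).le)) (hc1 i)
    linarith
  simp only [sub_mul, Finset.sum_sub_distrib, ← Finset.mul_sum, Finset.sum_const,
    Finset.card_range, nsmul_eq_mul] at h1
  nlinarith [mul_le_mul_of_nonneg_left hc (ha0 r)]

namespace Schmidt

variable {T : H →L[ℝ] K} {σ : ℕ → ℝ} {e : ℕ → H} {f : ℕ → K}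

theorem inner_sum_rankOne (h : Schmidt T σ e f) {r i : ℕ} (hi : i < r) (v : H) :
    inner ℝ (f i) ((T - ∑ i ∈ Finset.range r, rankOne ℝ (f i) (σ i • e i)) v) = 0 := by
  rw [sub_apply, inner_sub_right, ← adjoint_inner_left, h.adjoint_apply_right, sum_rankOne_apply,
    inner_sum, Finset.sum_eq_single i]
  · rw [inner_smul_right, h.inner_right]
    rcases (h.nonneg i).lt_or_eq with h0 | h0
    · simp [h0]
    · simp [← h0]
  · intro j _ hj
    rw [inner_smul_right, h.inner_right, if_neg (by tauto), mul_zero]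
  · intro hi'
    exact absurd (Finset.mem_range.2 hi) hi'

/-- The truncation has range in the span of the first `f i`, and the remainder has range orthogonal
to them. -/
theorem hsSq_eq_add_sum (h : Schmidt T σ e f) (r : ℕ) :
    hsSq T = hsSq (T - ∑ i ∈ Finset.range r, rankOne ℝ (f i) (σ i • e i)) +
      ∑ i ∈ Finset.range r, ENNReal.ofReal (σ i ^ 2) := by
  have h1 := hsSq_add_of_inner_eq_zero
    (R := T - ∑ i ∈ Finset.range r, rankOne ℝ (f i) (σ i • e i))
    (S := ∑ i ∈ Finset.range r, rankOne ℝ (f i) (σ i • e i)) fun v => by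
      rw [sum_rankOne_apply, inner_sum]
      refine Finset.sum_eq_zero fun i hi => ?_
      rw [inner_smul_right, real_inner_comm (f i), h.inner_sum_rankOne (Finset.mem_range.1 hi), mul_zero]
  rw [sub_add_cancel, hsSq_sum_rankOne] at h1
  · rw [h1]
    congr 1
    refine Finset.sum_congr rfl fun i _ => ?_
    rw [enorm_sq_eq_ofReal, enorm_sq_eq_ofReal, ← ENNReal.ofReal_mul (by positivity)]
    rcases (h.nonneg i).lt_or_eq with h0 | h0
    · rw [norm_smul, h.norm_left h0, h.norm_right h0]; simp
    · simp [← h0]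
  · intro i _ j _ hij
    rw [h.inner_right, if_neg fun h' => hij h'.1]

theorem hasSum_norm_adjoint_sq (h : Schmidt T σ e f) (q : K) :
    HasSum (fun i => σ i ^ 2 * inner ℝ (f i) q ^ 2) (‖adjoint T q‖ ^ 2) := by
  have h1 := (h.hasSum (adjoint T q)).mapL (innerSL ℝ q)
  rw [innerSL_apply_apply, ← adjoint_inner_left, real_inner_self_eq_norm_sq] at h1
  refine h1.congr_fun fun i => ?_
  rw [innerSL_apply_apply, inner_smul_right, adjoint_inner_right, h.apply_left, inner_smul_left,
    real_inner_comm q]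
  simp only [conj_trivial]
  ring

/-- Ky Fan's inequality. -/
theorem sum_norm_adjoint_sq_le (h : Schmidt T σ e f) {n r : ℕ} (hn : n ≤ r) {q : Fin n → K}
    (hq : Orthonormal ℝ q) :
    ∑ j, ‖adjoint T (q j)‖ ^ 2 ≤ ∑ i ∈ Finset.range r, σ i ^ 2 := by
  -- The weight of `σ i ^ 2` is at most `1` by Bessel for `q`, and the weights sum to at most `n ≤
  -- r` by Bessel for `f`.
  have hs : HasSum (fun i => σ i ^ 2 * ∑ j, inner ℝ (f i) (q j) ^ 2)
      (∑ j, ‖adjoint T (q j)‖ ^ 2) := by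
    simp only [Finset.mul_sum]
    exact hasSum_sum fun j _ => h.hasSum_norm_adjoint_sq (q j)
  have hf1 : ∀ i, ‖f i‖ ≤ 1 := by
    intro i
    rcases (h.nonneg i).lt_or_eq with h0 | h0
    · exact (h.norm_right h0).le
    · rw [h.right_eq_zero h0.symm]; simp
  refine le_of_tendsto hs.tendsto_sum_nat ?_
  filter_upwards [eventually_ge_atTop r] with N hN
  refine sum_mul_le_sum_of_antitone (a := fun i => σ i ^ 2) ?_ (fun i => sq_nonneg _)
    (fun i => Finset.sum_nonneg fun j _ => sq_nonneg _) ?_ hN ?_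
  · intro i j hij
    exact pow_le_pow_left₀ (h.nonneg j) (h.antitone hij) 2
  · intro i
    have h1 := hq.sum_inner_products_le (x := f i) (s := Finset.univ)
    simp only [Real.norm_eq_abs, sq_abs, real_inner_comm (f i)] at h1
    exact h1.trans (pow_le_one₀ (norm_nonneg _) (hf1 i))
  · rw [Finset.sum_comm]
    have h1 : ∀ j, ∑ i ∈ Finset.range N, inner ℝ (f i) (q j) ^ 2 ≤ 1 := by
      intro j
      -- Bessel for `f`, some of whose members may be zero: the sum is at most `‖p‖` and at least
      -- `‖p‖ ^ 2`.
      set p := ∑ i ∈ Finset.range N, inner ℝ (f i) (q j) • f i with hp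
      have hin : inner ℝ p (q j) = ∑ i ∈ Finset.range N, inner ℝ (f i) (q j) ^ 2 := by
        rw [hp, sum_inner]
        refine Finset.sum_congr rfl fun i _ => ?_
        rw [inner_smul_left, sq]; rfl
      have hnp : ‖p‖ ^ 2 ≤ ∑ i ∈ Finset.range N, inner ℝ (f i) (q j) ^ 2 := by
        rw [hp, norm_sum_sq_of_pairwise_inner]
        · refine Finset.sum_le_sum fun i _ => ?_
          rw [norm_smul, mul_pow, Real.norm_eq_abs, sq_abs]
          exact mul_le_of_le_one_right (sq_nonneg _) (pow_le_one₀ (norm_nonneg _) (hf1 i))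
        · intro i k hik
          rw [inner_smul_left, inner_smul_right, h.inner_right, if_neg fun h' => hik h'.1]
          simp
      have h2 := real_inner_le_norm p (q j)
      rw [hq.1 j, mul_one, hin] at h2
      nlinarith [norm_nonneg p]
    calc _ ≤ ∑ j : Fin n, (1 : ℝ) := Finset.sum_le_sum fun j _ => h1 j
      _ ≤ r := by simpa using hn

end Schmidt

/-- Truncated singular value decompositions are best approximations of rank at most `r`. -/
theorem hsSq_sub_truncated_le {T Y Y' : H →L[ℝ] K} {r : ℕ} (hY : IsTruncatedSVD r T Y)
    (hY' : Y' ∈ boundedRank r H K) : hsSq (T - Y) ≤ hsSq (T - Y') := by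
  obtain ⟨σ, e, f, h, rfl⟩ := isTruncatedSVD_iff.1 hY
  obtain ⟨n, hn, q, hq, hYq⟩ := exists_orthonormal_of_mem_boundedRank hY'
  -- `T` followed by the projection onto the range of `Y'`: the best approximation with values in
  -- that range.
  set Q := ∑ j, rankOne ℝ (q j) (adjoint T (q j)) with hQ
  have horth : ∀ j v, inner ℝ (q j) ((T - Q) v) = 0 := by
    intro j v
    rw [hQ, sub_apply, sum_rankOne_apply, inner_sub_right, inner_sum, Finset.sum_eq_single j]
    · rw [inner_smul_right, real_inner_self_eq_norm_sq, hq.1 j, adjoint_inner_left]; simp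
    · intro k _ hk
      rw [inner_smul_right, hq.2 hk.symm, mul_zero]
    · simp
  have hQv : ∀ v, Q v = ∑ j, inner ℝ (adjoint T (q j)) v • q j := sum_rankOne_apply _ _ _
  have hYv : ∀ v, Y' v = ∑ j, inner ℝ (adjoint Y' (q j)) v • q j := fun v => by
    conv_lhs => rw [hYq, sum_rankOne_apply]
  have h1 : hsSq T = hsSq (T - Q) + ∑ j, ENNReal.ofReal (‖adjoint T (q j)‖ ^ 2) := by
    have h2 := hsSq_add_of_inner_eq_zero (R := T - Q) (S := Q) fun v => by
      rw [hQv, inner_sum]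
      exact Finset.sum_eq_zero fun j _ => by
        rw [inner_smul_right, real_inner_comm (q j), horth, mul_zero]
    rw [sub_add_cancel] at h2
    rw [h2]
    congr 1
    rw [hQ, hsSq_sum_rankOne _ _ fun i _ j _ hij => hq.2 hij]
    refine Finset.sum_congr rfl fun j _ => ?_
    rw [enorm_sq_eq_ofReal, enorm_sq_eq_ofReal (q j), hq.1 j]; simp
  have h3 : hsSq (T - Q) ≤ hsSq (T - Y') := by
    have h2 := hsSq_add_of_inner_eq_zero (R := T - Q) (S := Q - Y') fun v => by
      rw [sub_apply Q, hYv, hQv, ← Finset.sum_sub_distrib, inner_sum]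
      refine Finset.sum_eq_zero fun j _ => ?_
      rw [← sub_smul, inner_smul_right, real_inner_comm (q j), horth, mul_zero]
    rw [sub_add_sub_cancel] at h2
    rw [h2]
    exact le_self_add
  have h4 := h.hsSq_eq_add_sum r
  have h5 : ∑ j, ENNReal.ofReal (‖adjoint T (q j)‖ ^ 2) ≤
      ∑ i ∈ Finset.range r, ENNReal.ofReal (σ i ^ 2) := by
    rw [← ENNReal.ofReal_sum_of_nonneg fun i _ => sq_nonneg _,
      ← ENNReal.ofReal_sum_of_nonneg fun i _ => sq_nonneg _]
    exact ENNReal.ofReal_le_ofReal (h.sum_norm_adjoint_sq_le hn hq)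
  have hfin : ∑ i ∈ Finset.range r, ENNReal.ofReal (σ i ^ 2) ≠ ⊤ :=
    ENNReal.sum_ne_top.2 fun i _ => ENNReal.ofReal_ne_top
  -- Only the finite sum of `σ i ^ 2` is cancelled, so `hsSq T` may be infinite here.
  rw [← ENNReal.add_le_add_iff_right hfin, ← h4, h1]
  exact add_le_add h3 h5

/-- Best approximations of rank at most `r` are truncated singular value decompositions. -/
theorem isTruncatedSVD_of_forall_le {T Y : H →L[ℝ] K} {r : ℕ} (hT : hsSq T ≠ ⊤)
    (hY : Y ∈ boundedRank r H K)
    (hmin : ∀ Y' ∈ boundedRank r H K, hsSq (T - Y) ≤ hsSq (T - Y')) : IsTruncatedSVD r T Y := by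
  obtain ⟨s, e, f, hs, hs0, hYs⟩ := exists_eq_sum_rankOne hY
  obtain ⟨R, hR⟩ : ∃ R, R = T - Y := ⟨_, rfl⟩
  have hRfin : hsSq R ≠ ⊤ := hR ▸ hsSq_sub_ne_top hT (hsSq_ne_top_of_mem_boundedRank hY)
  obtain ⟨τ, g, k, hτ⟩ := exists_schmidt hRfin
  have hlt : ∀ i, 0 < s i → i < r := fun i hi => by
    by_contra h
    exact hi.ne' (hs0 i (not_lt.1 h))
  have hYv : ∀ v, Y v = ∑ i ∈ Finset.range r, (s i * inner ℝ (e i) v) • f i := by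
    intro v
    conv_lhs => rw [hYs, sum_rankOne_apply]
    simp [inner_smul_left]
  -- Adding the component of the residual along `f i` keeps the rank at most `r` and would lower the
  -- error strictly if that component were nonzero. The same argument on the domain side gives
  -- `hleft`.
  have hright : ∀ i, adjoint R (f i) = 0 := by
    intro i
    rcases (hs.nonneg i).lt_or_eq with hi | hi
    · have h1 := hsSq_eq_sub_rankOne_left (hs.norm_right hi) R
      have h2 := hmin (Y + rankOne ℝ (f i) (adjoint R (f i))) (rank_le_of_eq_sum (f := f)
        (c := fun j v => s j * inner ℝ (e j) v + if j = i then inner ℝ (adjoint R (f i)) v else 0)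
        fun v => by
          simp [hYv, add_smul, Finset.sum_add_distrib, hlt i hi])
      rw [← sub_sub, ← hR] at h2
      have h3 : hsSq (R - rankOne ℝ (f i) (adjoint R (f i))) ≠ ⊤ :=
        hsSq_sub_ne_top hRfin (hsSq_rankOne_ne_top _ _)
      rw [h1] at h2
      have h4 := (ENNReal.add_le_add_iff_left h3).1 (h2.trans (add_zero _).ge)
      simpa using h4
    · rw [hs.right_eq_zero hi.symm, map_zero]
  have hleft : ∀ i, R (e i) = 0 := by
    intro i
    rcases (hs.nonneg i).lt_or_eq with hi | hi
    · have h1 := hsSq_eq_sub_rankOne_right (hs.norm_left hi) R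
      have h2 := hmin (Y + rankOne ℝ (R (e i)) (e i)) (rank_le_of_eq_sum
        (f := fun j => s j • f j + if j = i then R (e i) else 0)
        (c := fun j v => inner ℝ (e j) v)
        fun v => by
          simp [hYv, smul_add, Finset.sum_add_distrib, hlt i hi, smul_smul, mul_comm])
      rw [← sub_sub, ← hR] at h2
      have h3 : hsSq (R - rankOne ℝ (R (e i)) (e i)) ≠ ⊤ :=
        hsSq_sub_ne_top hRfin (hsSq_rankOne_ne_top _ _)
      rw [h1] at h2
      have h4 := (ENNReal.add_le_add_iff_left h3).1 (h2.trans (add_zero _).ge)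
      simpa using h4
    · rw [hs.left_eq_zero hi.symm, map_zero]
  -- Otherwise exchanging the last term of `Y` for the top term of the residual would be better. If
  -- `Y` has rank below `r`, then `s m = 0`, which forces the residual to vanish.
  have hcross : ∀ m, r = m + 1 → τ 0 ≤ s m := by
    rintro m rfl
    by_contra! hlt'
    have hτ0 : 0 < τ 0 := (hs.nonneg m).trans_lt hlt'
    have hRk : R - rankOne ℝ (R (g 0)) (g 0) = R - rankOne ℝ (k 0) (τ 0 • g 0) := by
      rw [hτ.apply_left]; ext v; simp
    have h1 := hsSq_eq_sub_rankOne_right (hτ.norm_left hτ0) R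
    rw [hRk] at h1
    have h2 := hmin (∑ i ∈ Finset.range m, rankOne ℝ (f i) (s i • e i) +
        rankOne ℝ (k 0) (τ 0 • g 0)) (by
      have := sum_rankOne_mem_boundedRank (m + 1) (fun i => if i < m then f i else k 0)
        (fun i => if i < m then s i • e i else τ 0 • g 0)
      rw [Finset.sum_range_succ] at this
      convert this using 2
      · refine Finset.sum_congr rfl fun i hi => ?_
        simp [Finset.mem_range.1 hi]
      · simp)
    have h3 : T - (∑ i ∈ Finset.range m, rankOne ℝ (f i) (s i • e i) +
        rankOne ℝ (k 0) (τ 0 • g 0)) =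
        (R - rankOne ℝ (k 0) (τ 0 • g 0)) + rankOne ℝ (f m) (s m • e m) := by
      have hT' : T = R + Y := by rw [hR, sub_add_cancel]
      rw [hT', hYs, Finset.sum_range_succ]
      abel
    rw [← hR, h3, hsSq_add_rankOne, h1] at h2
    · have h4 : hsSq (R - rankOne ℝ (k 0) (τ 0 • g 0)) ≠ ⊤ :=
        hsSq_sub_ne_top hRfin (hsSq_rankOne_ne_top _ _)
      have h5 := (ENNReal.add_le_add_iff_left h4).1 h2
      rw [enorm_sq_eq_ofReal, enorm_sq_eq_ofReal, enorm_sq_eq_ofReal,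
        ← ENNReal.ofReal_mul (by positivity), ENNReal.ofReal_le_ofReal_iff (by positivity),
        hτ.apply_left, norm_smul, norm_smul, hτ.norm_right hτ0, Real.norm_of_nonneg hτ0.le,
        Real.norm_of_nonneg (hs.nonneg m)] at h5
      rcases (hs.nonneg m).lt_or_eq with hm | hm
      · rw [hs.norm_left hm, hs.norm_right hm] at h5
        nlinarith
      · rw [← hm] at h5
        nlinarith
    · intro v
      have hk : inner ℝ (f m) (k 0) = 0 := by
        have h6 : inner ℝ (f m) (R (g 0)) = 0 := by
          rw [← adjoint_inner_left, hright, inner_zero_left]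
        rw [hτ.apply_left, inner_smul_right] at h6
        exact (mul_eq_zero.1 h6).resolve_left hτ0.ne'
      rw [sub_apply, inner_sub_right, rankOne_apply, inner_smul_right, hk, ← adjoint_inner_left,
        hright]
      simp
  have hce : ∀ i j, inner ℝ (e i) (g j) = 0 := by
    intro i j
    rcases (hτ.nonneg j).lt_or_eq with hj | hj
    · have h6 : inner ℝ (e i) (adjoint R (k j)) = 0 := by
        rw [adjoint_inner_right, hleft, inner_zero_left]
      rw [hτ.adjoint_apply_right, inner_smul_right] at h6
      exact (mul_eq_zero.1 h6).resolve_left hj.ne'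
    · rw [hτ.left_eq_zero hj.symm, inner_zero_right]
  have hcf : ∀ i j, inner ℝ (f i) (k j) = 0 := by
    intro i j
    rcases (hτ.nonneg j).lt_or_eq with hj | hj
    · have h6 : inner ℝ (f i) (R (g j)) = 0 := by
        rw [← adjoint_inner_left, hright, inner_zero_left]
      rw [hτ.apply_left, inner_smul_right] at h6
      exact (mul_eq_zero.1 h6).resolve_left hj.ne'
    · rw [hτ.right_eq_zero hj.symm, inner_zero_right]
  -- The decompositions of `Y` and of the residual are concatenated: `hcross` makes the values
  -- monotone, `hce` and `hcf` the vectors orthogonal.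
  refine isTruncatedSVD_iff.2 ⟨fun i => if i < r then s i else τ (i - r),
    fun i => if i < r then e i else g (i - r), fun i => if i < r then f i else k (i - r),
    ⟨?_, ?_, ?_, ?_, ?_⟩, ?_⟩
  · intro i
    split_ifs
    exacts [hs.nonneg i, hτ.nonneg _]
  · intro i j hij
    dsimp only
    split_ifs with hj hi hi
    · exact hs.antitone hij
    · omega
    · obtain ⟨m, rfl⟩ : ∃ m, r = m + 1 := ⟨r - 1, by omega⟩
      exact (hτ.antitone (Nat.zero_le _)).trans
        ((hcross m rfl).trans (hs.antitone (Nat.lt_succ_iff.1 hi)))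
    · exact hτ.antitone (Nat.sub_le_sub_right hij r)
  · intro i j
    split_ifs <;> grind [hs.inner_left i j, hτ.inner_left (i - r) (j - r), real_inner_comm]
  · intro i j
    split_ifs <;> grind [hs.inner_right i j, hτ.inner_right (i - r) (j - r), real_inner_comm]
  · intro v
    have hTv : T v = R v + ∑ i ∈ Finset.range r, (s i * inner ℝ (e i) v) • f i := by
      rw [← hYv, hR, sub_apply, sub_add_cancel]
    have h1 := (hasSum_nat_add_iff (f := fun i => ((if i < r then s i else τ (i - r)) *
      inner ℝ (if i < r then e i else g (i - r)) v) • (if i < r then f i else k (i - r)))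
      (g := R v) r).1 (by simpa using hτ.hasSum v)
    rw [hTv]
    convert h1 using 2
    refine Finset.sum_congr rfl fun i hi => ?_
    simp [Finset.mem_range.1 hi]
  · rw [hYs]
    refine Finset.sum_congr rfl fun i hi => ?_
    simp [Finset.mem_range.1 hi]

end EckartYoung

/-! ### Square roots and the polar factor -/

section SquareRoot

open InnerProductSpace Filter Topology

variable {H K L : Type*}
  [NormedAddCommGroup H] [InnerProductSpace ℝ H] [CompleteSpace H]
  [NormedAddCommGroup K] [InnerProductSpace ℝ K] [CompleteSpace K]
  [NormedAddCommGroup L] [InnerProductSpace ℝ L] [CompleteSpace L]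

/-- A bounded operator mapping one orthonormal family to another one. -/
theorem exists_apply_eq_of_orthonormal {ι : Type*} {g : ι → K} {e : ι → H} (hg : Orthonormal ℝ g)
    (he : Orthonormal ℝ e) : ∃ W : K →L[ℝ] H, ∀ i, W (g i) = e i := by
  classical
  set Vg := hg.orthogonalFamily.linearIsometry.toContinuousLinearMap with hVg
  set Ve := he.orthogonalFamily.linearIsometry.toContinuousLinearMap with hVe
  have h1 : ∀ i, Vg (lp.single 2 i (1 : ℝ)) = g i := fun i => by
    simp [hVg, OrthogonalFamily.linearIsometry_apply_single]
  have h2 : ∀ i, Ve (lp.single 2 i (1 : ℝ)) = e i := fun i => by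
    simp [hVe, OrthogonalFamily.linearIsometry_apply_single]
  -- Both families come from the unit vectors of `ℓ²(ι)` through isometries, and `Vg*` is a left
  -- inverse of `Vg`.
  refine ⟨Ve ∘L adjoint Vg, fun i => ?_⟩
  have h3 : ∀ u, adjoint Vg (Vg u) = u := by
    intro u
    refine ext_inner_right ℝ fun v => ?_
    rw [adjoint_inner_left]
    exact hg.orthogonalFamily.linearIsometry.inner_map_map u v
  rw [comp_apply, ← h1, h3, h2]

/-- The root is `∑ σ i • (e i ⊗ e i)`. Writing it as `W U` with `W (f i) = e i` provides boundedness
and convergence at once. -/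
theorem exists_isPositive_sqrt {U : H →L[ℝ] K} (hU : hsSq U ≠ ⊤) :
    ∃ S : H →L[ℝ] H, S.IsPositive ∧ S ∘L S = adjoint U ∘L U := by
  obtain ⟨σ, e, f, h⟩ := exists_schmidt hU
  obtain ⟨W, hW⟩ := exists_apply_eq_of_orthonormal
    (g := fun i : {i // 0 < σ i} => f i) (e := fun i : {i // 0 < σ i} => e i)
    (orthonormal_iff_ite.2 fun i j => by
      rw [h.inner_right]; simp [i.2, Subtype.ext_iff])
    (orthonormal_iff_ite.2 fun i j => by
      rw [h.inner_left]; simp [i.2, Subtype.ext_iff])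
  have hW' : ∀ i, W (f i) = e i := by
    intro i
    rcases (h.nonneg i).lt_or_eq with hi | hi
    · exact hW ⟨i, hi⟩
    · rw [h.right_eq_zero hi.symm, h.left_eq_zero hi.symm, map_zero]
  set S := W ∘L U with hS
  have hsum : ∀ v, HasSum (fun i => (σ i * inner ℝ (e i) v) • e i) (S v) := by
    intro v
    refine ((h.hasSum v).mapL W).congr_fun fun i => ?_
    rw [map_smul, hW']
  have hSe : ∀ i, S (e i) = σ i • e i := by
    intro i
    rw [hS, comp_apply, h.apply_left, map_smul, hW']
  have hinner : ∀ v w, HasSum (fun i => σ i * (inner ℝ (e i) v * inner ℝ (e i) w))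
      (inner ℝ (S v) w) := by
    intro v w
    rw [real_inner_comm]
    refine ((hsum v).mapL (innerSL ℝ w)).congr_fun fun i => ?_
    rw [innerSL_apply_apply, inner_smul_right, real_inner_comm w]
    ring
  refine ⟨S, ⟨fun v w => ?_, fun v => ?_⟩, ?_⟩
  · change inner ℝ (S v) w = inner ℝ v (S w)
    rw [real_inner_comm (S w)]
    refine (hinner v w).unique ((hinner w v).congr_fun fun i => ?_)
    ring
  · rw [reApplyInnerSelf_apply]
    exact (hinner v v).nonneg fun i =>
      mul_nonneg (h.nonneg i) (mul_self_nonneg _)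
  · ext v
    refine ((hsum v).mapL S).unique (((h.hasSum v).mapL (adjoint U)).congr_fun fun i => ?_)
    rw [map_smul, map_smul, hSe, h.adjoint_apply_right]

theorem opSqrt_spec {U : H →L[ℝ] K} (hU : hsSq U ≠ ⊤) :
    (opSqrt (adjoint U ∘L U)).IsPositive ∧
      opSqrt (adjoint U ∘L U) ∘L opSqrt (adjoint U ∘L U) = adjoint U ∘L U :=
  Classical.epsilon_spec (exists_isPositive_sqrt hU)

/-- The partial isometry in a factorisation `U = J S` when `‖U g‖ = ‖S g‖`. -/
theorem exists_partialIsometry {S : H →L[ℝ] L} {U : H →L[ℝ] K} (h : ∀ g, ‖U g‖ = ‖S g‖) :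
    ∃ J : L →L[ℝ] K, (∀ g, J (S g) = U g) ∧ ∀ v w, inner ℝ (J v) (J w) =
      inner ℝ (projClosure (LinearMap.range (S : H →ₗ[ℝ] L)) v) w := by
  set V := (LinearMap.range (S : H →ₗ[ℝ] L)).topologicalClosure with hV
  have hmem : ∀ g, S g ∈ V := fun g => Submodule.le_topologicalClosure _ ⟨g, rfl⟩
  let s : H →ₗ[ℝ] V := (S : H →ₗ[ℝ] L).codRestrict V hmem
  have hdense : DenseRange s := by
    rintro ⟨v, hv⟩
    rw [closure_subtype]
    have h1 : (Subtype.val '' Set.range s : Set L) = LinearMap.range (S : H →ₗ[ℝ] L) := by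
      rw [← Set.range_comp]; rfl
    rw [h1]
    exact hv
  have hb : ∀ g, ‖(U : H →ₗ[ℝ] K) g‖ ≤ 1 * ‖s g‖ := fun g => by
    rw [one_mul]; exact (h g).le
  -- `S g ↦ U g` is isometric on a dense subspace of `V`, hence extends to `V`; the projection onto
  -- `V` then extends it by zero.
  set J₀ := (U : H →ₗ[ℝ] K).extendOfNorm s with hJ₀
  have hJs : ∀ g, J₀ (s g) = U g := fun g => LinearMap.extendOfNorm_eq hdense ⟨1, hb⟩ g
  have hJn : ∀ v, ‖J₀ v‖ = ‖v‖ := by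
    intro v
    refine hdense.induction (P := fun v => ‖J₀ v‖ = ‖v‖) ?_
      (isClosed_eq (by fun_prop) (by fun_prop)) v
    rintro _ ⟨g, rfl⟩
    rw [hJs]
    exact h g
  let J₁ : V →ₗᵢ[ℝ] K := ⟨J₀, hJn⟩
  refine ⟨J₀ ∘L V.orthogonalProjectionOnto, fun g => ?_, fun v w => ?_⟩
  · rw [comp_apply, ← hJs]
    congr 1
    exact Subtype.ext (Submodule.starProjection_eq_self_iff.2 (hmem g))
  · change inner ℝ (J₁ _) (J₁ _) = inner ℝ (V.starProjection v) w
    rw [J₁.inner_map_map, Submodule.coe_inner]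
    change inner ℝ (V.starProjection v) (V.starProjection w) = _
    rw [← Submodule.inner_starProjection_left_eq_right,
      Submodule.starProjection_eq_self_iff.2 (V.starProjection_apply_mem v)]

end SquareRoot

/-! ### Random vectors as operators into `L²(P)` -/

section SquareIntegrable

open Filter

variable {Ω : Type*} [MeasurableSpace Ω] {P : Measure Ω}
  {E E' : Type*} [NormedAddCommGroup E] [InnerProductSpace ℝ E] [CompleteSpace E]
  [NormedAddCommGroup E'] [InnerProductSpace ℝ E'] [CompleteSpace E']

/-- The operator `g ↦ ⟨g, w⟩` from `E` to `L²(P)` for square-integrable `w`. -/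
def evalL2 {w : Ω → E} (hw : MemLp w 2 P) : E →L[ℝ] Lp ℝ 2 P :=
  LinearMap.mkContinuous
    { toFun := fun g => (hw.const_inner (𝕜 := ℝ) g).toLp _
      map_add' := fun g g' => by
        rw [← MemLp.toLp_add]
        exact MemLp.toLp_congr _ _ (Eventually.of_forall fun ω => by simp [inner_add_left])
      map_smul' := fun c g => by
        rw [RingHom.id_apply, ← MemLp.toLp_const_smul]
        exact MemLp.toLp_congr _ _ (Eventually.of_forall fun ω => by simp [inner_smul_left]) }
    ‖hw.toLp w‖ fun g => by
      rw [mul_comm]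
      refine Lp.norm_le_mul_norm_of_ae_le_mul ?_
      filter_upwards [(hw.const_inner (𝕜 := ℝ) g).coeFn_toLp, hw.coeFn_toLp] with ω h1 h2
      change ‖((hw.const_inner (𝕜 := ℝ) g).toLp _ : Ω → ℝ) ω‖ ≤ _
      rw [h1, h2]
      exact norm_inner_le_norm _ _

theorem evalL2_apply {w : Ω → E} (hw : MemLp w 2 P) (g : E) :
    evalL2 hw g = (hw.const_inner (𝕜 := ℝ) g).toLp _ := rfl

theorem coeFn_evalL2 {w : Ω → E} (hw : MemLp w 2 P) (g : E) :
    evalL2 hw g =ᵐ[P] fun ω => inner ℝ g (w ω) :=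
  (hw.const_inner (𝕜 := ℝ) g).coeFn_toLp

theorem enorm_toLp_sq {f : Ω → ℝ} (hf : MemLp f 2 P) :
    ‖hf.toLp f‖ₑ ^ 2 = ∫⁻ ω, ‖f ω‖ₑ ^ 2 ∂P := by
  rw [Lp.enorm_toLp]
  have := eLpNorm_nnreal_pow_eq_lintegral (f := f) (μ := P) (p := 2) two_ne_zero
  simpa using this

/-- Orthonormal vectors are `√2` apart, so balls of radius `1/2` around them are disjoint.
Countability permits exchanging sum and integral below. -/
theorem countable_of_orthonormal [TopologicalSpace.SeparableSpace E] {ι : Type*} {b : ι → E}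
    (hb : Orthonormal ℝ b) : Countable ι := by
  have hd : Pairwise fun i j => Disjoint (Metric.ball (b i) 2⁻¹) (Metric.ball (b j) 2⁻¹) := by
    intro i j hij
    refine Metric.ball_disjoint_ball ?_
    have h1 : ‖b i - b j‖ ^ 2 = 2 := by
      rw [norm_sub_sq_real, hb.1 i, hb.1 j, hb.2 hij]; norm_num
    rw [dist_eq_norm]
    nlinarith [norm_nonneg (b i - b j)]
  have := Pairwise.countable_of_isOpen_disjoint hd (fun i => Metric.isOpen_ball)
    (fun i => ⟨b i, Metric.mem_ball_self (by norm_num)⟩)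
  exact this

/-- Tonelli over a countable basis, then Parseval for each `ω`. -/
theorem hsSq_evalL2 [TopologicalSpace.SeparableSpace E] {w : Ω → E} (hw : MemLp w 2 P) :
    hsSq (evalL2 hw) = ∫⁻ ω, ‖w ω‖ₑ ^ 2 ∂P := by
  obtain ⟨v, b, -⟩ := exists_hilbertBasis ℝ E
  have : Countable v := countable_of_orthonormal b.orthonormal
  rw [hsSq_eq_tsum b]
  simp only [evalL2_apply, enorm_toLp_sq]
  rw [← lintegral_tsum fun i => ((hw.const_inner (𝕜 := ℝ) (b i)).1.enorm).pow_const 2]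
  simp only [tsum_enorm_inner_sq]

theorem hsSq_evalL2_ne_top [TopologicalSpace.SeparableSpace E] {w : Ω → E} (hw : MemLp w 2 P) :
    hsSq (evalL2 hw) ≠ ⊤ := by
  rw [hsSq_evalL2]
  have h1 := eLpNorm_nnreal_pow_eq_lintegral (f := w) (μ := P) (p := 2) two_ne_zero
  have h2 : eLpNorm w 2 P ^ 2 = ∫⁻ ω, ‖w ω‖ₑ ^ 2 ∂P := by simpa using h1
  rw [← h2]
  exact ENNReal.pow_ne_top hw.2.ne

theorem integral_norm_sq_eq_hsSq [TopologicalSpace.SeparableSpace E] {w : Ω → E}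
    (hw : MemLp w 2 P) : ∫ ω, ‖w ω‖ ^ 2 ∂P = (hsSq (evalL2 hw)).toReal := by
  rw [hsSq_evalL2, integral_eq_lintegral_of_nonneg_ae (Eventually.of_forall fun ω => sq_nonneg _)
    (hw.1.norm.pow 2)]
  simp only [enorm_sq_eq_ofReal]

theorem uncenteredCov_eq_adjoint_comp {w : Ω → E} {z : Ω → E'} (hw : MemLp w 2 P)
    (hz : MemLp z 2 P) : uncenteredCov P w z = adjoint (evalL2 hw) ∘L evalL2 hz := by
  ext e
  refine ext_inner_right ℝ fun f => ?_
  rw [inner_uncenteredCov P hw hz, comp_apply, adjoint_inner_left, L2.inner_def]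
  refine integral_congr_ae ?_
  filter_upwards [coeFn_evalL2 hw f, coeFn_evalL2 hz e] with ω h1 h2
  rw [h1, h2, real_inner_comm f]
  simp

theorem evalL2_sub_comp {F G H₁ : Type*} [NormedAddCommGroup F] [InnerProductSpace ℝ F]
    [CompleteSpace F] [NormedAddCommGroup G] [InnerProductSpace ℝ G] [CompleteSpace G]
    [NormedAddCommGroup H₁] [InnerProductSpace ℝ H₁] [CompleteSpace H₁] {x : Ω → F} {y : Ω → G}
    (hx : MemLp x 2 P) (hy : MemLp y 2 P) (V : F →L[ℝ] H₁) (W : G →L[ℝ] H₁)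
    (hd : MemLp (fun ω => V (x ω) - W (y ω)) 2 P) :
    evalL2 hd = evalL2 hx ∘L adjoint V - evalL2 hy ∘L adjoint W := by
  ext1 g
  refine Lp.ext ?_
  rw [sub_apply]
  filter_upwards [coeFn_evalL2 hd g, coeFn_evalL2 hx (adjoint V g), coeFn_evalL2 hy (adjoint W g),
    Lp.coeFn_sub (evalL2 hx (adjoint V g)) (evalL2 hy (adjoint W g))] with ω h1 h2 h3 h4
  rw [h1, comp_apply, comp_apply, h4, Pi.sub_apply, h2, h3, inner_sub_right, adjoint_inner_left,
    adjoint_inner_left]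

end SquareIntegrable

/-! ### Evaluating Moore–Penrose inverses -/

section MoorePenrose

variable {H K L : Type*}
  [NormedAddCommGroup H] [InnerProductSpace ℝ H] [CompleteSpace H]
  [NormedAddCommGroup K] [InnerProductSpace ℝ K] [CompleteSpace K]
  [NormedAddCommGroup L] [InnerProductSpace ℝ L] [CompleteSpace L]

theorem moorePenrose_apply {T : H →L[ℝ] K} {u : H}
    (hu : u ∈ (LinearMap.ker (T : H →ₗ[ℝ] K))ᗮ) (z : (moorePenrose T).domain)
    (hz : (z : K) = T u) : moorePenrose T z = u := by
  have hmem : T u ∈ (restrictedInverse T).domain := by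
    rw [restrictedInverse_domain]
    exact ⟨u, rfl⟩
  unfold moorePenrose
  rw [LinearPMap.sup_apply _ ⟨T u, hmem⟩ 0 z (by rw [hz]; exact add_zero _), LinearPMap.map_zero,
    add_zero]
  exact LinearPMap.inverse_apply_eq (ker_restricted_eq_bot T)
    (x := (⟨u, hu⟩ : ((T : H →ₗ[ℝ] K).toPMap (LinearMap.ker (T : H →ₗ[ℝ] K))ᗮ).domain)) rfl

/-- If `R = S Z` with `ran Z ⊆ (ker S)ᗮ` then `S† R = Z`. -/
theorem isOperator_compOn_moorePenrose {S : H →L[ℝ] K} {R : L →L[ℝ] K} {Z : L →L[ℝ] H}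
    (h : ∀ v, S (Z v) = R v) (hZ : ∀ v, Z v ∈ (LinearMap.ker (S : H →ₗ[ℝ] K))ᗮ) :
    IsOperator (compOn (moorePenrose S) R) Z := by
  refine LinearPMap.ext (Eq.symm (eq_top_iff.2 fun v _ => ?_)) ?_
  · change R v ∈ (moorePenrose S).domain
    rw [moorePenrose_domain]
    exact Submodule.mem_sup_left ⟨Z v, h v⟩
  · intro v hv hv'
    exact (moorePenrose_apply (hZ v) ⟨R v, hv'⟩ (h v).symm).symm

end MoorePenrose

/-! ### Reduction of the mean square error to approximation of `T` -/

section CostDecomposition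

variable {H K : Type*}
  [NormedAddCommGroup H] [InnerProductSpace ℝ H] [CompleteSpace H]
  [NormedAddCommGroup K] [InnerProductSpace ℝ K] [CompleteSpace K]

theorem hsSq_add_of_inner_adjoint_eq_zero {R S : H →L[ℝ] K}
    (h : ∀ v, inner ℝ (adjoint R v) (adjoint S v) = 0) : hsSq (R + S) = hsSq R + hsSq S := by
  rw [← hsSq_adjoint, map_add, hsSq_add_of_inner_eq_zero h, hsSq_adjoint, hsSq_adjoint]

theorem hsSq_eq_add_comp_starProjection (R : H →L[ℝ] K) (V : Submodule ℝ H)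
    [V.HasOrthogonalProjection] :
    hsSq R = hsSq (R - R ∘L V.starProjection) + hsSq (R ∘L V.starProjection) := by
  rw [← hsSq_add_of_inner_adjoint_eq_zero, sub_add_cancel]
  intro v
  have : adjoint (R ∘L V.starProjection) = V.starProjection ∘L adjoint R := by
    rw [adjoint_comp, (isSelfAdjoint_starProjection V).adjoint_eq]
  rw [map_sub, this, sub_apply, comp_apply]
  exact V.starProjection_inner_eq_zero _ _ (V.starProjection_apply_mem _)

theorem comp_adjoint_comp_starProjection {H₂ : Type*} [NormedAddCommGroup H₂]
    [InnerProductSpace ℝ H₂] [CompleteSpace H₂] (W : H₂ →L[ℝ] H) :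
    adjoint W ∘L projClosure (LinearMap.range (W : H₂ →ₗ[ℝ] H)) = adjoint W := by
  ext v
  refine ext_inner_right ℝ fun w => ?_
  rw [comp_apply, adjoint_inner_left, adjoint_inner_left]
  unfold projClosure
  rw [Submodule.inner_starProjection_left_eq_right, Submodule.starProjection_eq_self_iff.2]
  exact Submodule.le_topologicalClosure _ ⟨w, rfl⟩

variable {Ω : Type*} [MeasurableSpace Ω] {P : Measure Ω}
    {F G H₁ H₂ H₃ : Type*}
    [NormedAddCommGroup F] [InnerProductSpace ℝ F] [CompleteSpace F]
    [TopologicalSpace.SeparableSpace F]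
    [NormedAddCommGroup G] [InnerProductSpace ℝ G] [CompleteSpace G]
    [TopologicalSpace.SeparableSpace G]
    [NormedAddCommGroup H₁] [InnerProductSpace ℝ H₁] [CompleteSpace H₁]
    [TopologicalSpace.SeparableSpace H₁]
    [NormedAddCommGroup H₂] [InnerProductSpace ℝ H₂] [CompleteSpace H₂]
    [NormedAddCommGroup H₃] [InnerProductSpace ℝ H₃] [CompleteSpace H₃]

/-- The target operator is everywhere defined and Hilbert--Schmidt, and up to a constant the mean
square error is a squared Hilbert--Schmidt distance to it. -/
theorem exists_target {x : Ω → F} {y : Ω → G} (hx : MemLp x 2 P) (hy : MemLp y 2 P)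
    (Wx : F →L[ℝ] H₁) (WA : H₂ →L[ℝ] H₁) (Wy : G →L[ℝ] H₃) :
    ∃ T : H₁ →L[ℝ] G, IsOperator (targetPMap P x y Wx WA Wy) T ∧ hsSq T ≠ ⊤ ∧
      (∀ v, T v ∈ (LinearMap.range (sqrtCovWeight P y Wy : H₃ →ₗ[ℝ] G)).topologicalClosure) ∧
      T ∘L projClosure (LinearMap.range (WA : H₂ →ₗ[ℝ] H₁)) = T ∧
      ∃ c : ENNReal, ∀ A : H₃ →L[ℝ] H₂,
        c + hsSq (T - sqrtCovWeight P y Wy ∘L adjoint A ∘L adjoint WA) ≠ ⊤ ∧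
        meanSqError P x y Wx WA Wy A =
          (c + hsSq (T - sqrtCovWeight P y Wy ∘L adjoint A ∘L adjoint WA)).toReal := by
  set U := evalL2 hy with hU
  set X := evalL2 hx with hX
  have hUfin : hsSq U ≠ ⊤ := hsSq_evalL2_ne_top hy
  have hXfin : hsSq X ≠ ⊤ := hsSq_evalL2_ne_top hx
  set S := opSqrt (uncenteredCov P y y) with hS
  obtain ⟨hSpos, hSS⟩ : S.IsPositive ∧ S ∘L S = adjoint U ∘L U := by
    have := opSqrt_spec hUfin
    rwa [← uncenteredCov_eq_adjoint_comp hy hy] at this ⊢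
  have hSsa : adjoint S = S := hSpos.isSelfAdjoint.adjoint_eq
  have hnorm : ∀ g, ‖U g‖ = ‖S g‖ := by
    intro g
    rw [← sq_eq_sq₀ (norm_nonneg _) (norm_nonneg _), ← real_inner_self_eq_norm_sq,
      ← real_inner_self_eq_norm_sq, ← adjoint_inner_left, ← adjoint_inner_left S, hSsa]
    change inner ℝ ((adjoint U ∘L U) g) g = inner ℝ ((S ∘L S) g) g
    rw [hSS]
  obtain ⟨J, hJS, hJJ⟩ := exists_partialIsometry hnorm
  set B := sqrtCovWeight P y Wy with hB
  have hBv : ∀ v, B v = S (adjoint Wy v) := fun v => rfl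
  set V := (LinearMap.range (S : G →ₗ[ℝ] G)).topologicalClosure with hV
  set VB := (LinearMap.range (B : H₃ →ₗ[ℝ] G)).topologicalClosure with hVB
  set VA := (LinearMap.range (WA : H₂ →ₗ[ℝ] H₁)).topologicalClosure with hVA
  have hVBV : VB ≤ V := Submodule.topologicalClosure_mono (by
    rintro _ ⟨v, rfl⟩
    exact ⟨adjoint Wy v, rfl⟩)
  have hJJ' : ∀ v w, inner ℝ (J v) (J w) = inner ℝ (V.starProjection v) w := hJJ
  have hJB : ∀ v, J (B v) = U (adjoint Wy v) := fun v => by rw [hBv, hJS]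
  set Ξ := X ∘L adjoint Wx with hΞ
  have hΞfin : hsSq Ξ ≠ ⊤ := hsSq_comp_clm_ne_top hXfin _
  set R₀ := adjoint J ∘L Ξ ∘L VA.starProjection with hR₀
  set T := VB.starProjection ∘L R₀ with hT
  have hidem : VA.starProjection ∘L VA.starProjection = VA.starProjection :=
    VA.isIdempotentElem_starProjection
  refine ⟨T, ?_, ?_, ?_, ?_, ?_⟩
  -- `S J* = U*` gives `S R₀ = C_yx Wx* P_A`, and `J` kills `ker S`, so `J*` maps into `(ker S)ᗮ`;
  -- thus `R₀` is `S†` applied to the covariance term.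
  · have h1 : IsOperator (compOn (moorePenrose S) (uncenteredCov P y x ∘L adjoint Wx ∘L
        projClosure (LinearMap.range (WA : H₂ →ₗ[ℝ] H₁)))) R₀ := by
      refine isOperator_compOn_moorePenrose (fun v => ?_) fun v => ?_
      · rw [uncenteredCov_eq_adjoint_comp hy hx]
        refine ext_inner_right ℝ fun w => ?_
        rw [← hSsa, adjoint_inner_left]
        change inner ℝ (adjoint J (Ξ (VA.starProjection v))) (S w) =
          inner ℝ (adjoint U (Ξ (VA.starProjection v))) w
        rw [adjoint_inner_left, hJS, adjoint_inner_left]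
      · refine (Submodule.mem_orthogonal _ _).2 fun k hk => ?_
        have hk' : S k = 0 := hk
        have h2 : V.starProjection k = 0 := by
          rw [Submodule.starProjection_apply_eq_zero_iff, hV, Submodule.orthogonal_closure]
          refine (Submodule.mem_orthogonal _ _).2 ?_
          rintro _ ⟨g, rfl⟩
          change inner ℝ (S g) k = 0
          rw [← hSsa, adjoint_inner_left, hk', inner_zero_right]
        have h3 : J k = 0 := by
          rw [← inner_self_eq_zero (𝕜 := ℝ), hJJ', h2, inner_zero_left]
        change inner ℝ k (adjoint J _) = 0
        rw [adjoint_inner_right, h3, inner_zero_left]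
    unfold targetPMap
    rw [← hS, ← h1]
    rfl
  · exact hsSq_clm_comp_ne_top _ (hsSq_clm_comp_ne_top _ (hsSq_comp_clm_ne_top hΞfin _))
  · exact fun v => VB.starProjection_apply_mem _
  · change VB.starProjection ∘L (adjoint J ∘L Ξ ∘L VA.starProjection) ∘L VA.starProjection = _
    rw [comp_assoc, comp_assoc, hidem]
  -- The parts no `A` can reach: `Ξ` off the closure of `ran WA`, and the component of `Ξ P_A`
  -- orthogonal to the image under `J` of the closure of `ran B`.
  · refine ⟨hsSq (Ξ - Ξ ∘L VA.starProjection) + hsSq (Ξ ∘L VA.starProjection - J ∘L T),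
      fun A => ?_⟩
    set N := B ∘L adjoint A ∘L adjoint WA with hN
    have hd : MemLp (fun ω => Wx (x ω) - (WA ∘L A ∘L Wy) (y ω)) 2 P :=
      (Wx.comp_memLp' hx).sub ((WA ∘L A ∘L Wy).comp_memLp' hy)
    have hD : evalL2 hd = Ξ - J ∘L N := by
      rw [evalL2_sub_comp hx hy Wx (WA ∘L A ∘L Wy) hd, adjoint_comp, adjoint_comp]
      congr 1
      ext1 v
      exact (hJB _).symm
    have hNV : N ∘L VA.starProjection = N := by
      rw [hN, comp_assoc, comp_assoc]
      congr 2
      exact comp_adjoint_comp_starProjection WA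
    have hNB : ∀ v, N v ∈ VB := fun v => Submodule.le_topologicalClosure _ ⟨_, rfl⟩
    have hsplit : hsSq (evalL2 hd) = hsSq (Ξ - Ξ ∘L VA.starProjection) +
        hsSq (Ξ ∘L VA.starProjection - J ∘L T) + hsSq (T - N) := by
      have h1 : (Ξ - J ∘L N) ∘L VA.starProjection = Ξ ∘L VA.starProjection - J ∘L N := by
        rw [sub_comp, show (J ∘L N) ∘L VA.starProjection = J ∘L N ∘L VA.starProjection from rfl, hNV]
      have h2 : Ξ ∘L VA.starProjection - J ∘L N =
          (Ξ ∘L VA.starProjection - J ∘L T) + J ∘L (T - N) := by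
        rw [comp_sub]; abel
      have hTmem : ∀ v, T v ∈ VB := fun v => VB.starProjection_apply_mem _
      have hmem : ∀ v, (T - N) v ∈ VB := fun v => VB.sub_mem (hTmem v) (hNB v)
      rw [hD, hsSq_eq_add_comp_starProjection _ VA, h1, add_assoc, sub_sub_sub_cancel_right]
      congr 1
      rw [h2, hsSq_add_of_inner_eq_zero]
      · congr 1
        refine hsSq_comp_of_norm_eq fun v => ?_
        rw [comp_apply, ← sq_eq_sq₀ (norm_nonneg _) (norm_nonneg _), ← real_inner_self_eq_norm_sq,
          hJJ', Submodule.starProjection_eq_self_iff.2 (hVBV (hmem v)), real_inner_self_eq_norm_sq]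
      · intro v
        rw [sub_apply, comp_apply J, comp_apply J, inner_sub_left, hJJ',
          Submodule.starProjection_eq_self_iff.2 (hVBV (hTmem v)),
          ← adjoint_inner_left]
        change inner ℝ (R₀ v) _ - inner ℝ (VB.starProjection (R₀ v)) _ = 0
        rw [Submodule.inner_starProjection_left_eq_right,
          Submodule.starProjection_eq_self_iff.2 (hmem v), sub_self]
    rw [← hsplit]
    exact ⟨hsSq_evalL2_ne_top hd, integral_norm_sq_eq_hsSq hd⟩

end CostDecomposition

/-! ### Truncated SVDs versus operators `B A* WA*` -/

section Optimality

open InnerProductSpace Filter Topology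

variable {G H₁ H₂ H₃ : Type*}
    [NormedAddCommGroup G] [InnerProductSpace ℝ G] [CompleteSpace G]
    [NormedAddCommGroup H₁] [InnerProductSpace ℝ H₁] [CompleteSpace H₁]
    [NormedAddCommGroup H₂] [InnerProductSpace ℝ H₂] [CompleteSpace H₂]
    [NormedAddCommGroup H₃] [InnerProductSpace ℝ H₃] [CompleteSpace H₃]
    {T : H₁ →L[ℝ] G} {WA : H₂ →L[ℝ] H₁} {B : H₃ →L[ℝ] G} {r : ℕ}

theorem exists_preimage_mem_ker_orthogonal (W : H₂ →L[ℝ] H₁) {v : H₁}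
    (hv : v ∈ LinearMap.range (W : H₂ →ₗ[ℝ] H₁)) :
    ∃ u ∈ (LinearMap.ker (W : H₂ →ₗ[ℝ] H₁))ᗮ, W u = v := by
  obtain ⟨h, rfl⟩ := hv
  set N := LinearMap.ker (W : H₂ →ₗ[ℝ] H₁) with hN
  have : CompleteSpace N := W.completeSpace_ker
  refine ⟨h - N.starProjection h, N.sub_starProjection_mem_orthogonal h, ?_⟩
  have h1 : W (N.starProjection h) = 0 := N.starProjection_apply_mem h
  rw [map_sub, h1, sub_zero]
  rfl

theorem eq_of_apply_eq_of_mem_ker_orthogonal {W : H₂ →L[ℝ] H₁} {u v : H₂}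
    (hu : u ∈ (LinearMap.ker (W : H₂ →ₗ[ℝ] H₁))ᗮ) (hv : v ∈ (LinearMap.ker (W : H₂ →ₗ[ℝ] H₁))ᗮ)
    (h : W u = W v) : u = v := by
  have h1 : u - v ∈ LinearMap.ker (W : H₂ →ₗ[ℝ] H₁) := by
    change W (u - v) = 0
    rw [map_sub, h, sub_self]
  have h2 := (Submodule.mem_orthogonal _ _).1 (Submodule.sub_mem _ hu hv) _ h1
  exact sub_eq_zero.1 (inner_self_eq_zero.1 h2)

theorem adjoint_apply_mem_range (hWA : IsClosed (LinearMap.range (WA : H₂ →ₗ[ℝ] H₁) : Set H₁))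
    (hTA : T ∘L projClosure (LinearMap.range (WA : H₂ →ₗ[ℝ] H₁)) = T) (g : G) :
    adjoint T g ∈ LinearMap.range (WA : H₂ →ₗ[ℝ] H₁) := by
  have h : adjoint (projClosure (LinearMap.range (WA : H₂ →ₗ[ℝ] H₁))) =
      projClosure (LinearMap.range (WA : H₂ →ₗ[ℝ] H₁)) :=
    (isSelfAdjoint_starProjection _).adjoint_eq
  rw [← hTA, adjoint_comp, h, comp_apply]
  have h1 : projClosure (LinearMap.range (WA : H₂ →ₗ[ℝ] H₁)) (adjoint T g) ∈
      (LinearMap.range (WA : H₂ →ₗ[ℝ] H₁)).topologicalClosure := Submodule.starProjection_apply_mem _ _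
  rwa [hWA.submodule_topologicalClosure_eq] at h1

/-- Left singular vectors lie in the range of `WA`. -/
theorem exists_left_preimages (hWA : IsClosed (LinearMap.range (WA : H₂ →ₗ[ℝ] H₁) : Set H₁))
    (hTA : T ∘L projClosure (LinearMap.range (WA : H₂ →ₗ[ℝ] H₁)) = T) {σ : ℕ → ℝ} {e : ℕ → H₁}
    {f : ℕ → G} (h : Schmidt T σ e f) :
    ∃ n : ℕ → H₂, ∀ i, n i ∈ (LinearMap.ker (WA : H₂ →ₗ[ℝ] H₁))ᗮ ∧ WA (n i) = σ i • e i := by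
  have : ∀ i, ∃ u ∈ (LinearMap.ker (WA : H₂ →ₗ[ℝ] H₁))ᗮ, WA u = σ i • e i := fun i =>
    exists_preimage_mem_ker_orthogonal WA (h.adjoint_apply_right i ▸
      adjoint_apply_mem_range hWA hTA (f i))
  choose n hn1 hn2 using this
  exact ⟨n, fun i => ⟨hn1 i, hn2 i⟩⟩

theorem comp_adjoint_sum_rankOne (n : ℕ → H₂) (m : ℕ → H₃) :
    B ∘L adjoint (∑ i ∈ Finset.range r, rankOne ℝ (n i) (m i)) ∘L adjoint WA =
      ∑ i ∈ Finset.range r, rankOne ℝ (B (m i)) (WA (n i)) := by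
  ext v
  simp [adjoint_inner_right, sum_apply]

/-- Operators `B A* WA*` of rank at most `r` approximate as well as all operators do. -/
theorem hsSq_sub_le_of_forall_le
    (hTB : ∀ v, T v ∈ (LinearMap.range (B : H₃ →ₗ[ℝ] G)).topologicalClosure)
    (hWA : IsClosed (LinearMap.range (WA : H₂ →ₗ[ℝ] H₁) : Set H₁))
    (hTA : T ∘L projClosure (LinearMap.range (WA : H₂ →ₗ[ℝ] H₁)) = T) {Y : H₁ →L[ℝ] G}
    (hY : IsTruncatedSVD r T Y) {c : ENNReal}
    (hc : ∀ A ∈ boundedRank r H₃ H₂, c ≤ hsSq (T - B ∘L adjoint A ∘L adjoint WA)) :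
    c ≤ hsSq (T - Y) := by
  obtain ⟨σ, e, f, h, rfl⟩ := isTruncatedSVD_iff.1 hY
  obtain ⟨n, hn⟩ := exists_left_preimages hWA hTA h
  have hf : ∀ i, ∃ m : ℕ → H₃, Tendsto (fun k => B (m k)) atTop (𝓝 (f i)) := by
    intro i
    -- For `σ i > 0`, `f i` is a multiple of `T (e i)`.
    have hmem : f i ∈ (LinearMap.range (B : H₃ →ₗ[ℝ] G)).topologicalClosure := by
      rcases (h.nonneg i).lt_or_eq with hi | hi
      · have h1 := Submodule.smul_mem _ (σ i)⁻¹ (hTB (e i))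
        rwa [h.apply_left, smul_smul, inv_mul_cancel₀ hi.ne', one_smul] at h1
      · rw [h.right_eq_zero hi.symm]
        exact Submodule.zero_mem _
    obtain ⟨u, hu, hlim⟩ := mem_closure_iff_seq_limit.1 hmem
    choose m hm using hu
    exact ⟨m, hlim.congr fun k => (hm k).symm⟩
  choose m hm using hf
  set Y := ∑ i ∈ Finset.range r, rankOne ℝ (f i) (σ i • e i) with hYdef
  have hbound : ∀ k, c ≤ hsSq (T - Y) +
      ∑ i ∈ Finset.range r, ‖f i - B (m i k)‖ₑ ^ 2 * ‖σ i • e i‖ₑ ^ 2 := by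
    intro k
    refine (hc _ (sum_rankOne_mem_boundedRank r n fun i => m i k)).trans (le_of_eq ?_)
    have h1 : T - B ∘L adjoint (∑ i ∈ Finset.range r, rankOne ℝ (n i) (m i k)) ∘L adjoint WA =
        (T - Y) + ∑ i ∈ Finset.range r, rankOne ℝ (f i - B (m i k)) (σ i • e i) := by
      rw [comp_adjoint_sum_rankOne]
      simp only [(hn _).2, map_sub, sub_apply, Finset.sum_sub_distrib]
      rw [hYdef]
      abel
    -- The perturbation acts only on the first `r` vectors `e i`, which the remainder annihilates;
    -- so the errors add without cross terms.
    have hkill : ∀ i < r, (T - Y) (σ i • e i) = 0 := by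
      intro i hi
      rw [map_smul, sub_apply, h.apply_left, hYdef, sum_rankOne_apply, Finset.sum_eq_single i]
      · rw [inner_smul_left, h.inner_left]
        rcases (h.nonneg i).lt_or_eq with h0 | h0
        · simp [h0]
        · simp [← h0]
      · intro j _ hj
        rw [inner_smul_left, h.inner_left, if_neg (by tauto), mul_zero, zero_smul]
      · intro hi'
        exact absurd (Finset.mem_range.2 hi) hi'
    rw [h1, hsSq_add_of_inner_adjoint_eq_zero]
    · congr 1
      rw [← hsSq_adjoint, adjoint_sum_rankOne, hsSq_sum_rankOne]
      intro i _ j _ hij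
      rw [inner_smul_left, inner_smul_right, h.inner_left, if_neg fun h' => hij h'.1]
      simp
    · intro v
      rw [adjoint_sum_rankOne, sum_rankOne_apply, inner_sum]
      refine Finset.sum_eq_zero fun i hi => ?_
      rw [inner_smul_right, adjoint_inner_left, hkill i (Finset.mem_range.1 hi), inner_zero_right,
        mul_zero]
  have hlim : Tendsto (fun k => hsSq (T - Y) +
      ∑ i ∈ Finset.range r, ‖f i - B (m i k)‖ₑ ^ 2 * ‖σ i • e i‖ₑ ^ 2) atTop
      (𝓝 (hsSq (T - Y) + ∑ i ∈ Finset.range r, 0)) := by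
    refine tendsto_const_nhds.add (tendsto_finsetSum _ fun i _ => ?_)
    have h1 : Tendsto (fun k => ‖f i - B (m i k)‖ₑ ^ 2) atTop (𝓝 0) := by
      have h2 := ((ENNReal.continuous_pow 2).tendsto _).comp ((hm i).const_sub (f i)).enorm
      simpa [Function.comp_def] using h2
    have h3 := ENNReal.Tendsto.mul_const (b := ‖σ i • e i‖ₑ ^ 2) h1 (Or.inr (by finiteness))
    simpa using h3
  rw [Finset.sum_const_zero, add_zero] at hlim
  exact ge_of_tendsto' hlim hbound

/-- Passing to the adjoint turns the projection on the right into a condition on the range of `A*`,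
so `WA` and `B` can be cancelled separately. -/
theorem isMinimal_iff {A : H₃ →L[ℝ] H₂} : IsMinimal WA B A ↔
    (∀ v, A v ∈ (LinearMap.ker (WA : H₂ →ₗ[ℝ] H₁))ᗮ) ∧
      ∀ v, adjoint A v ∈ (LinearMap.ker (B : H₃ →ₗ[ℝ] G))ᗮ := by
  set p := (LinearMap.ker (WA : H₂ →ₗ[ℝ] H₁))ᗮ with hp
  set q := (LinearMap.ker (B : H₃ →ₗ[ℝ] G))ᗮ with hq
  constructor
  · intro h
    have h' : p.starProjection ∘L A ∘L q.starProjection = A := h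
    refine ⟨fun v => ?_, fun v => ?_⟩
    · rw [← h']
      exact p.starProjection_apply_mem _
    · rw [← h', adjoint_comp, adjoint_comp, (isSelfAdjoint_starProjection q).adjoint_eq]
      exact q.starProjection_apply_mem _
  · rintro ⟨h1, h2⟩
    have h3 : A ∘L q.starProjection = A := by
      ext v
      refine ext_inner_right ℝ fun w => ?_
      rw [comp_apply, ← adjoint_inner_right, Submodule.inner_starProjection_left_eq_right,
        Submodule.starProjection_eq_self_iff.2 (h2 w), adjoint_inner_right]
    change p.starProjection ∘L A ∘L q.starProjection = A
    rw [h3]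
    ext v
    exact Submodule.starProjection_eq_self_iff.2 (h1 v)

/-- The operators `Z = B† Y` and `Â = WA† Z*` of an admissible `Y`. -/
theorem exists_explicit (hWA : IsClosed (LinearMap.range (WA : H₂ →ₗ[ℝ] H₁) : Set H₁))
    (hTA : T ∘L projClosure (LinearMap.range (WA : H₂ →ₗ[ℝ] H₁)) = T) {Y : H₁ →L[ℝ] G}
    (hY : IsAdmissible r T B Y) :
    ∃ (Z : H₁ →L[ℝ] H₃) (A : H₃ →L[ℝ] H₂),
      IsOperator (compOn (moorePenrose B) Y) Z ∧ IsOperator (compOn (moorePenrose WA) (adjoint Z)) A ∧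
      A ∈ boundedRank r H₃ H₂ ∧ IsMinimal WA B A ∧ B ∘L adjoint A ∘L adjoint WA = Y := by
  obtain ⟨hYT, hYB⟩ := hY
  obtain ⟨σ, e, f, h, hYs⟩ := isTruncatedSVD_iff.1 hYT
  obtain ⟨n, hn⟩ := exists_left_preimages hWA hTA h
  -- Admissibility enters here: for `i < r` with `σ i > 0`, `f i = Y ((σ i)⁻¹ • e i)` lies in `ran
  -- Y`, hence in `ran B`.
  have hm : ∀ i, ∃ u ∈ (LinearMap.ker (B : H₃ →ₗ[ℝ] G))ᗮ, i < r → B u = f i := by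
    intro i
    by_cases hi : i < r
    · rcases (h.nonneg i).lt_or_eq with h0 | h0
      · have hYe : Y ((σ i)⁻¹ • e i) = f i := by
          rw [hYs, sum_rankOne_apply, Finset.sum_eq_single i]
          · rw [inner_smul_left, inner_smul_right, h.inner_left]
            simp [h0, h0.ne']
          · intro j _ hj
            rw [inner_smul_left, inner_smul_right, h.inner_left, if_neg (by tauto)]
            simp
          · intro hi'
            exact absurd (Finset.mem_range.2 hi) hi'
        obtain ⟨u, hu, hBu⟩ := exists_preimage_mem_ker_orthogonal B (hYB ⟨_, hYe⟩)
        exact ⟨u, hu, fun _ => hBu⟩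
      · exact ⟨0, Submodule.zero_mem _, fun _ => by rw [h.right_eq_zero h0.symm, map_zero]⟩
    · exact ⟨0, Submodule.zero_mem _, fun h' => absurd h' hi⟩
  choose m hm1 hm2 using hm
  -- The weight `σ i` sits in `n i`, since `WA (n i) = σ i • e i` while `B (m i) = f i`.
  set A := ∑ i ∈ Finset.range r, rankOne ℝ (n i) (m i) with hA
  set Z := ∑ i ∈ Finset.range r, rankOne ℝ (m i) (σ i • e i) with hZ
  have hZker : ∀ v, Z v ∈ (LinearMap.ker (B : H₃ →ₗ[ℝ] G))ᗮ := fun v => by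
    rw [hZ, sum_rankOne_apply]
    exact Submodule.sum_mem _ fun i _ => Submodule.smul_mem _ _ (hm1 i)
  have hAker : ∀ v, A v ∈ (LinearMap.ker (WA : H₂ →ₗ[ℝ] H₁))ᗮ := fun v => by
    rw [hA, sum_rankOne_apply]
    exact Submodule.sum_mem _ fun i _ => Submodule.smul_mem _ _ (hn i).1
  refine ⟨Z, A, isOperator_compOn_moorePenrose (fun v => ?_) hZker,
    isOperator_compOn_moorePenrose (fun v => ?_) hAker, sum_rankOne_mem_boundedRank r n m,
    isMinimal_iff.2 ⟨hAker, fun v => ?_⟩, ?_⟩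
  · rw [hZ, hYs, sum_rankOne_apply, sum_rankOne_apply, map_sum]
    refine Finset.sum_congr rfl fun i hi => ?_
    rw [map_smul, hm2 i (Finset.mem_range.1 hi)]
  · rw [hZ, hA, adjoint_sum_rankOne, sum_rankOne_apply, sum_rankOne_apply, map_sum]
    refine Finset.sum_congr rfl fun i hi => ?_
    rw [map_smul, (hn i).2]
  · rw [hA, adjoint_sum_rankOne, sum_rankOne_apply]
    exact Submodule.sum_mem _ fun i _ => Submodule.smul_mem _ _ (hm1 i)
  · rw [hA, comp_adjoint_sum_rankOne, hYs]
    refine Finset.sum_congr rfl fun i hi => ?_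
    rw [hm2 i (Finset.mem_range.1 hi), (hn i).2]

/-- Minimal operators are determined by `B A* WA*`. -/
theorem IsMinimal.eq_of_comp_eq {A A' : H₃ →L[ℝ] H₂} (hA : IsMinimal WA B A)
    (hA' : IsMinimal WA B A')
    (h : B ∘L adjoint A ∘L adjoint WA = B ∘L adjoint A' ∘L adjoint WA) : A = A' := by
  obtain ⟨h1, h2⟩ := isMinimal_iff.1 hA
  obtain ⟨h1', h2'⟩ := isMinimal_iff.1 hA'
  have h3 : adjoint A ∘L adjoint WA = adjoint A' ∘L adjoint WA := by
    ext v
    exact eq_of_apply_eq_of_mem_ker_orthogonal (h2 _) (h2' _) (DFunLike.congr_fun h v)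
  rw [← adjoint_comp, ← adjoint_comp] at h3
  have h4 : WA ∘L A = WA ∘L A' := adjoint.injective h3
  ext v
  exact eq_of_apply_eq_of_mem_ker_orthogonal (h1 v) (h1' v) (DFunLike.congr_fun h4 v)

end Optimality

end RankConstrained

end

/-! ### Existence, explicit solution and uniqueness -/

theorem mainTheorem9
    {Ω : Type*} [MeasurableSpace Ω] [MeasurableSpace.CountablyGenerated Ω]
    (P : Measure Ω) [IsProbabilityMeasure P]
    {F G H₁ H₂ H₃ : Type*}
    [NormedAddCommGroup F] [InnerProductSpace ℝ F] [CompleteSpace F]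
    [TopologicalSpace.SeparableSpace F]
    [NormedAddCommGroup G] [InnerProductSpace ℝ G] [CompleteSpace G]
    [TopologicalSpace.SeparableSpace G]
    [NormedAddCommGroup H₁] [InnerProductSpace ℝ H₁] [CompleteSpace H₁]
    [TopologicalSpace.SeparableSpace H₁]
    [NormedAddCommGroup H₂] [InnerProductSpace ℝ H₂] [CompleteSpace H₂]
    [TopologicalSpace.SeparableSpace H₂]
    [NormedAddCommGroup H₃] [InnerProductSpace ℝ H₃] [CompleteSpace H₃]
    [TopologicalSpace.SeparableSpace H₃]
    (x : Ω → F) (y : Ω → G) (hx : MemLp x 2 P) (hy : MemLp y 2 P)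
    (Wx : F →L[ℝ] H₁) (WA : H₂ →L[ℝ] H₁) (Wy : G →L[ℝ] H₃)
    (hWA : IsClosed (LinearMap.range (WA : H₂ →ₗ[ℝ] H₁) : Set H₁)) (r : ℕ) :
    ∃ T : H₁ →L[ℝ] G,
      IsOperator (targetPMap P x y Wx WA Wy) T ∧ IsCompactOperator T ∧
      -- existence
      ((∃ A : H₃ →L[ℝ] H₂, IsSolution P x y Wx WA Wy r A) ↔
        ∃ Y : H₁ →L[ℝ] G, IsAdmissible r T (sqrtCovWeight P y Wy) Y) ∧
      -- explicit solution, minimality property and uniqueness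
      ∀ Y : H₁ →L[ℝ] G, IsAdmissible r T (sqrtCovWeight P y Wy) Y →
        ∃ (Z : H₁ →L[ℝ] H₃) (Ahat : H₃ →L[ℝ] H₂),
          IsOperator (compOn (moorePenrose (sqrtCovWeight P y Wy)) Y) Z ∧
          IsOperator (compOn (moorePenrose WA) (adjoint Z)) Ahat ∧
          IsSolution P x y Wx WA Wy r Ahat ∧
          IsMinimal WA (sqrtCovWeight P y Wy) Ahat ∧
          ((∀ A : H₃ →L[ℝ] H₂, IsSolution P x y Wx WA Wy r A →
              IsMinimal WA (sqrtCovWeight P y Wy) A → A = Ahat) ↔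
            ∀ Y' : H₁ →L[ℝ] G, IsAdmissible r T (sqrtCovWeight P y Wy) Y' → Y' = Y) := by
  obtain ⟨T, hop, hfin, hTB, hTA, c, hcost⟩ := exists_target hx hy Wx WA Wy
  set B := sqrtCovWeight P y Wy
  have hsol : ∀ A, IsSolution P x y Wx WA Wy r A ↔ A ∈ boundedRank r H₃ H₂ ∧
      ∀ A' ∈ boundedRank r H₃ H₂, hsSq (T - B ∘L adjoint A ∘L adjoint WA) ≤
        hsSq (T - B ∘L adjoint A' ∘L adjoint WA) := by
    intro A
    refine and_congr_right fun _ => forall₂_congr fun A' _ => ?_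
    change meanSqError P x y Wx WA Wy A ≤ meanSqError P x y Wx WA Wy A' ↔ _
    rw [(hcost A).2, (hcost A').2, ENNReal.toReal_le_toReal (hcost A).1 (hcost A').1,
      ENNReal.add_le_add_iff_left (ENNReal.add_ne_top.1 (hcost A).1).1]
  have hadm : ∀ A, IsSolution P x y Wx WA Wy r A →
      IsAdmissible r T B (B ∘L adjoint A ∘L adjoint WA) := by
    intro A hA
    obtain ⟨hAr, hmin⟩ := (hsol A).1 hA
    refine ⟨isTruncatedSVD_of_forall_le hfin (comp_adjoint_comp_mem_boundedRank hAr _ _)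
      fun Y' hY' => ?_, ?_⟩
    · obtain ⟨σ, e, f, h⟩ := exists_schmidt hfin
      have hY₀ := (isTruncatedSVD_iff (r := r)).2 ⟨σ, e, f, h, rfl⟩
      -- A solution does as well as some truncated SVD, admissible or not, hence as well as every
      -- operator of rank at most `r`.
      exact (hsSq_sub_le_of_forall_le hTB hWA hTA hY₀ hmin).trans (hsSq_sub_truncated_le hY₀ hY')
    · rintro _ ⟨v, rfl⟩
      exact ⟨_, rfl⟩
  have hexp : ∀ Y, IsAdmissible r T B Y → ∀ A ∈ boundedRank r H₃ H₂,
      B ∘L adjoint A ∘L adjoint WA = Y → IsSolution P x y Wx WA Wy r A := by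
    intro Y hY A hA hAY
    refine (hsol A).2 ⟨hA, fun A' hA' => ?_⟩
    rw [hAY]
    exact hsSq_sub_truncated_le hY.1 (comp_adjoint_comp_mem_boundedRank hA' _ _)
  refine ⟨T, hop, isCompactOperator_of_hsSq_ne_top hfin, ⟨?_, ?_⟩, fun Y hY => ?_⟩
  · rintro ⟨A, hA⟩
    exact ⟨_, hadm A hA⟩
  · rintro ⟨Y, hY⟩
    obtain ⟨Z, A, -, -, hA, -, hAY⟩ := exists_explicit hWA hTA hY
    exact ⟨A, hexp Y hY A hA hAY⟩
  · obtain ⟨Z, A, hZ, hAZ, hA, hAmin, hAY⟩ := exists_explicit hWA hTA hY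
    refine ⟨Z, A, hZ, hAZ, hexp Y hY A hA hAY, hAmin, fun h Y' hY' => ?_, fun h A' hA' hmin' => ?_⟩
    -- Another admissible `Y'` yields its own minimal solution, from which `Y'` is recovered as `B
    -- A'* WA*`.
    · obtain ⟨Z', A', -, -, hA', hAmin', hAY'⟩ := exists_explicit hWA hTA hY'
      rw [← hAY', ← hAY, h A' (hexp Y' hY' A' hA' hAY') hAmin']
    · exact hmin'.eq_of_comp_eq hAmin ((h _ (hadm A' hA')).trans hAY.symm)
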